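/- Let $M$ be a closed connected smooth $3$-manifold, let $X$ be a nowhere-vanishing $C^1$ vector field on $M$, and let $\phi^t$ be the flow generated by $X$. Let $\tilde\phi^t$ denote the linear flow induced by $\phi^t_*$ on the normal bundle $TM/\langle X\rangle$. The flow $\phi^t$ is called \emph{projectively Anosov} if there are a continuous splitting $TM/\langle X\rangle = E^s\oplus E^u$ into line bundles invariant under $\tilde\phi^t$, a continuous norm $\|\cdot\|$ on $TM/\langle X\rangle$ and a constant $C>0$ such that $$\frac{\|\tilde\phi^t v\|}{\|\tilde\phi^t u\|}\ \ge\ e^{Ct}\,\frac{\|v\|}{\|u\|}$$ for all $t\ge 0$ and all $x\in M$, $0\ne u\in E^s_x$, $v\in E^u_x$. It is called \emph{Anosov} if there are a continuous $\phi^t_*$-invariant splitting $TM=E^{ss}\oplus E^{uu}\oplus\langle X\rangle$ with $E^{ss},E^{uu}$ line bundles, a continuous norm on $TM$ and a constant $C>0$ such that $\|\phi^t_*u\|\le e^{-Ct}\|u\|$ and $\|\phi^t_*v\|\ge e^{Ct}\|v\|$ for all $t\ge 0$, $u\in E^{ss}$, $v\in E^{uu}$. Suppose that $\phi^t$ is projectively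 Anosov. Then: (1) If $\phi^t$ preserves some $C^0$ volume form, that is, there is a continuous nowhere-vanishing $3$-form $\Omega$ on $M$ with $(\phi^t)^*\Omega=\Omega$ for all $t$, then $\phi^t$ is Anosov. (2) In particular, if $\phi^t$ is contact, that is, there is a $C^1$ $1$-form $\alpha$ on $M$ with $\alpha\wedge d\alpha$ nowhere zero such that $X$ is transverse to the plane field $\xi=\ker\alpha$ and $\phi^t_*\xi=\xi$ for all $t$, then $\phi^t$ is Anosov. -/

import Mathlib

open scoped Manifold ContDiff Topology

noncomputable section

namespace PAFlow

/-- The model space of a three-manifold. -/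
abbrev E3 : Type := EuclideanSpace ℝ (Fin 3)

section

universe u

variable {M : Type u} [TopologicalSpace M] [ChartedSpace E3 M]

/-- A vector field, as an assignment of a tangent vector to every point. -/
abbrev VField (M : Type u) [TopologicalSpace M] [ChartedSpace E3 M] : Type u :=
  ∀ x : M, TangentSpace (𝓡 3) x

/-- `X` is a `C^1` vector field. -/
def IsC1Field [IsManifold (𝓡 3) ∞ M] (X : VField M) : Prop :=
  ContMDiff (𝓡 3) (𝓡 3).tangent 1 (fun x => (⟨x, X x⟩ : TangentBundle (𝓡 3) M))

/-- `φ` is the flow generated by `X`: every orbit `t ↦ φ t x` is an integral curve of `X`. -/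
def Generates (X : VField M) (φ : Flow ℝ M) : Prop :=
  ∀ x : M, IsMIntegralCurve (I := 𝓡 3) (fun t : ℝ => φ t x) X

/-- The differential `T_x M → T_{φ t x} M` of the time-`t` map of the flow. -/
def dflow (φ : Flow ℝ M) (t : ℝ) (x : M) :
    TangentSpace (𝓡 3) x →L[ℝ] TangentSpace (𝓡 3) (φ t x) :=
  mfderiv (𝓡 3) (𝓡 3) (fun z : M => φ t z) x

/-! ### Continuous subbundles, continuous norms, Anosov flows -/

/-- `L` is a continuous field of lines in `TM` (a continuous line subbundle): around every point it
is spanned by a continuous nowhere-zero local vector field. -/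
def IsContLineField [IsManifold (𝓡 3) ∞ M] (L : ∀ x : M, Submodule ℝ (TangentSpace (𝓡 3) x)) : Prop :=
  ∀ x₀ : M, ∃ U ∈ 𝓝 x₀, ∃ e : VField M,
    ContinuousOn (fun x => (⟨x, e x⟩ : TangentBundle (𝓡 3) M)) U ∧
    ∀ x ∈ U, e x ≠ 0 ∧ L x = Submodule.span ℝ {e x}

/-- `N` is a continuous norm on the vector bundle `TM`. -/
def IsContNorm [IsManifold (𝓡 3) ∞ M] (N : ∀ x : M, Seminorm ℝ (TangentSpace (𝓡 3) x)) : Prop :=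
  (∀ x v, N x v = 0 → v = 0) ∧ Continuous (fun p : TangentBundle (𝓡 3) M => N p.1 p.2)

/-- The flow `φ` generated by `X` is Anosov: there are a continuous splitting
`TM = Ess ⊕ Euu ⊕ ⟨X⟩` invariant under the flow, with `Ess` and `Euu` line bundles, a continuous norm
on `TM` and a constant `C > 0` such that, for `t ≥ 0`, vectors in `Ess` are contracted by at least
`e^{-Ct}` and vectors in `Euu` are expanded by at least `e^{Ct}`. -/
def IsAnosov [IsManifold (𝓡 3) ∞ M] (X : VField M) (φ : Flow ℝ M) : Prop :=
  ∃ Ess Euu : ∀ x : M, Submodule ℝ (TangentSpace (𝓡 3) x),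
    IsContLineField Ess ∧ IsContLineField Euu ∧
    (∀ x, Disjoint (Ess x) (Euu x) ∧ IsCompl (Ess x ⊔ Euu x) (Submodule.span ℝ {X x})) ∧
    (∀ t x, (Ess x).map (dflow φ t x).toLinearMap = Ess (φ t x)) ∧
    (∀ t x, (Euu x).map (dflow φ t x).toLinearMap = Euu (φ t x)) ∧
    ∃ N : ∀ x : M, Seminorm ℝ (TangentSpace (𝓡 3) x), IsContNorm N ∧
      ∃ C : ℝ, 0 < C ∧ ∀ t : ℝ, 0 ≤ t → ∀ x : M,
        (∀ w ∈ Ess x, N (φ t x) (dflow φ t x w) ≤ Real.exp (-C * t) * N x w) ∧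
        (∀ v ∈ Euu x, Real.exp (C * t) * N x v ≤ N (φ t x) (dflow φ t x v))

/-! ### The normal bundle `TM / ⟨X⟩`, the Poincaré linear flow, projectively Anosov flows -/

/-- The fibre at `x` of the normal bundle `TM / ⟨X⟩`. -/
abbrev NormalSpace (X : VField M) (x : M) : Type :=
  TangentSpace (𝓡 3) x ⧸ Submodule.span ℝ {X x}

/-- The projection `π : TM → TM / ⟨X⟩` on the fibre at `x`. -/
abbrev normalProj (X : VField M) (x : M) : TangentSpace (𝓡 3) x →ₗ[ℝ] NormalSpace X x :=
  (Submodule.span ℝ {X x}).mkQ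

/-- The differential of the flow maps the line spanned by the generator to itself. -/
theorem span_le_comap_dflow {X : VField M} {φ : Flow ℝ M}
    (h : Generates X φ) (t : ℝ) (x : M) :
    Submodule.span ℝ {X x} ≤
      (Submodule.span ℝ {X (φ t x)}).comap (dflow φ t x).toLinearMap := by
  rw [Submodule.span_singleton_le_iff_mem, Submodule.mem_comap]
  by_cases hd : MDifferentiableAt (𝓡 3) (𝓡 3) (fun z : M => φ t z) x
  · have h1 : HasMFDerivAt 𝓘(ℝ, ℝ) (𝓡 3) (fun s : ℝ => φ s x) 0
        ((1 : ℝ →L[ℝ] ℝ).smulRight (X (φ 0 x))) := h x 0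
    have h2 : HasMFDerivAt 𝓘(ℝ, ℝ) (𝓡 3) (fun s : ℝ => φ s (φ t x)) 0
        ((1 : ℝ →L[ℝ] ℝ).smulRight (X (φ 0 (φ t x)))) := h (φ t x) 0
    have hd' : MDifferentiableAt (𝓡 3) (𝓡 3) (fun z : M => φ t z) (φ 0 x) := by
      rwa [φ.map_zero_apply]
    have h3 := HasMFDerivAt.comp (0 : ℝ) hd'.hasMFDerivAt h1
    have he : ((fun z : M => φ t z) ∘ fun s : ℝ => φ s x) = fun s : ℝ => φ s (φ t x) := by
      funext s
      simp only [Function.comp_apply]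
      rw [← φ.map_add, ← φ.map_add, add_comm]
    rw [he] at h3
    have h4 := congrArg (fun A => A (1 : ℝ)) (hasMFDerivAt_unique h3 h2)
    have key : dflow φ t x (X x) = X (φ t x) := by
      have e1 : ∀ y : M, y = x →
          (mfderiv (𝓡 3) (𝓡 3) (fun z : M => φ t z) y (X y) : E3) =
            mfderiv (𝓡 3) (𝓡 3) (fun z : M => φ t z) x (X x) := by
        rintro y rfl; rfl
      have e2 : ∀ y : M, y = φ t x → (X y : E3) = X (φ t x) := by
        rintro y rfl; rfl
      have h5 : (mfderiv (𝓡 3) (𝓡 3) (fun z : M => φ t z) (φ 0 x) (((1 : ℝ →L[ℝ] ℝ) 1) • X (φ 0 x))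
            : E3) = ((1 : ℝ →L[ℝ] ℝ) 1) • X (φ 0 (φ t x)) := h4
      simp only [one_apply_eq_self, one_smul] at h5
      exact (e1 _ (φ.map_zero_apply x)).symm.trans (h5.trans (e2 _ (φ.map_zero_apply _)))
    have : (dflow φ t x).toLinearMap (X x) = X (φ t x) := key
    rw [this]
    exact Submodule.mem_span_singleton_self _
  · have : (dflow φ t x).toLinearMap (X x) = 0 := by
      change dflow φ t x (X x) = 0
      rw [dflow, mfderiv_zero_of_not_mdifferentiableAt hd]
      rfl
    rw [this]
    exact Submodule.zero_mem _

/-- The Poincaré linear flow: the map `T_x M / ⟨X⟩ → T_{φ t x} M / ⟨X⟩` induced by the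
differential of the time-`t` map. -/
def poincareFlow {X : VField M} {φ : Flow ℝ M} (h : Generates X φ) (t : ℝ) (x : M) :
    NormalSpace X x →ₗ[ℝ] NormalSpace X (φ t x) :=
  Submodule.mapQ _ _ (dflow φ t x).toLinearMap (span_le_comap_dflow h t x)

/-- `L` is a continuous field of lines in `TM / ⟨X⟩` (a continuous line subbundle): around every
point it is spanned by a nowhere-zero local section of `TM / ⟨X⟩`, the image of a continuous local
vector field. -/
def IsContNormalLineField [IsManifold (𝓡 3) ∞ M] (X : VField M)
    (L : ∀ x : M, Submodule ℝ (NormalSpace X x)) : Prop :=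
  ∀ x₀ : M, ∃ U ∈ 𝓝 x₀, ∃ e : VField M,
    ContinuousOn (fun x => (⟨x, e x⟩ : TangentBundle (𝓡 3) M)) U ∧
    ∀ x ∈ U, normalProj X x (e x) ≠ 0 ∧ L x = Submodule.span ℝ {normalProj X x (e x)}

/-- `N` is a continuous norm on the vector bundle `TM / ⟨X⟩` (which carries the quotient topology
of `TM`). -/
def IsContNormalNorm [IsManifold (𝓡 3) ∞ M] (X : VField M)
    (N : ∀ x : M, Seminorm ℝ (NormalSpace X x)) : Prop :=
  (∀ x v, N x v = 0 → v = 0) ∧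
    Continuous (fun p : TangentBundle (𝓡 3) M => N p.1 (normalProj X p.1 p.2))

/-- The flow `φ` generated by `X` is projectively Anosov: there are a continuous splitting
`TM / ⟨X⟩ = Es ⊕ Eu` into line bundles, invariant under the Poincaré linear flow, a continuous norm
on `TM / ⟨X⟩` and a constant `C > 0` such that, for `t ≥ 0`, the ratio of the norms of a vector in
`Eu` and a vector in `Es` grows by at least a factor `e^{Ct}`. -/
def IsProjectivelyAnosov [IsManifold (𝓡 3) ∞ M] {X : VField M} {φ : Flow ℝ M}
    (h : Generates X φ) : Prop :=
  ∃ Es Eu : ∀ x : M, Submodule ℝ (NormalSpace X x),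
    IsContNormalLineField X Es ∧ IsContNormalLineField X Eu ∧
    (∀ x, IsCompl (Es x) (Eu x)) ∧
    (∀ t x, (Es x).map (poincareFlow h t x) = Es (φ t x)) ∧
    (∀ t x, (Eu x).map (poincareFlow h t x) = Eu (φ t x)) ∧
    ∃ N : ∀ x : M, Seminorm ℝ (NormalSpace X x), IsContNormalNorm X N ∧
      ∃ C : ℝ, 0 < C ∧ ∀ t : ℝ, 0 ≤ t → ∀ x : M, ∀ w ∈ Es x, w ≠ 0 → ∀ v ∈ Eu x,
        Real.exp (C * t) * (N x v / N x w) ≤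
          N (φ t x) (poincareFlow h t x v) / N (φ t x) (poincareFlow h t x w)

/-! ### Volume forms and contact structures -/

/-- A differential `3`-form. -/
abbrev ThreeForm (M : Type u) [TopologicalSpace M] [ChartedSpace E3 M] : Type u :=
  ∀ x : M, TangentSpace (𝓡 3) x [⋀^Fin 3]→L[ℝ] ℝ

/-- The coordinate expression of a `3`-form in the chart at `x₀`: its pullback by the inverse of
the chart. -/
def threeFormInChart (Ω : ThreeForm M) (x₀ : M) (y : E3) : E3 [⋀^Fin 3]→L[ℝ] ℝ :=
  (Ω ((extChartAt (𝓡 3) x₀).symm y)).compContinuousLinearMap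
    (mfderiv 𝓘(ℝ, E3) (𝓡 3) (extChartAt (𝓡 3) x₀).symm y)

/-- A `C^0` volume form: a continuous nowhere-vanishing `3`-form. -/
def IsC0VolumeForm (Ω : ThreeForm M) : Prop :=
  (∀ x₀ : M, ContinuousOn (threeFormInChart Ω x₀) (extChartAt (𝓡 3) x₀).target) ∧
    ∀ x, Ω x ≠ 0

/-- The flow preserves the `3`-form `Ω`: `(φ^t)^* Ω = Ω` for all `t`. -/
def PreservesForm (φ : Flow ℝ M) (Ω : ThreeForm M) : Prop :=
  ∀ t x, (Ω (φ t x)).compContinuousLinearMap (dflow φ t x) = Ω x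

/-- A differential `1`-form, as a field of covectors. -/
abbrev OneForm (M : Type u) [TopologicalSpace M] [ChartedSpace E3 M] : Type u :=
  ∀ x : M, TangentSpace (𝓡 3) x →L[ℝ] ℝ

/-- The coordinate expression of a `1`-form in the chart at `x₀`. -/
def oneFormInChart (α : OneForm M) (x₀ : M) (y : E3) : E3 →L[ℝ] ℝ :=
  (α ((extChartAt (𝓡 3) x₀).symm y)).comp
    (mfderiv 𝓘(ℝ, E3) (𝓡 3) (extChartAt (𝓡 3) x₀).symm y)

/-- The exterior derivative of a `1`-form on `ℝ³`, evaluated at `y`. -/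
def extDerivOne (a : E3 → E3 →L[ℝ] ℝ) (y : E3) : E3 [⋀^Fin 2]→L[ℝ] ℝ :=
  extDeriv (fun z => ContinuousAlternatingMap.ofSubsingleton ℝ E3 ℝ (0 : Fin 1) (a z)) y

/-- The wedge product `a ∧ b` of a covector and a `2`-covector:
`(a ∧ b)(v₀, v₁, v₂) = a v₀ b(v₁, v₂) - a v₁ b(v₀, v₂) + a v₂ b(v₀, v₁)`. -/
def wedgeOneTwo (a : E3 →L[ℝ] ℝ) (b : E3 [⋀^Fin 2]→L[ℝ] ℝ) : E3 [⋀^Fin 3]→L[ℝ] ℝ :=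
  ContinuousAlternatingMap.alternatizeUncurryFin (a.smulRight b)

/-- `α` is a contact form: a `C^1` differential `1`-form such that `α ∧ dα` vanishes nowhere. -/
def IsContactForm (α : OneForm M) : Prop :=
  ∀ x₀ : M,
    ContDiffOn ℝ 1 (oneFormInChart α x₀) (extChartAt (𝓡 3) x₀).target ∧
    ∀ y ∈ (extChartAt (𝓡 3) x₀).target,
      wedgeOneTwo (oneFormInChart α x₀ y) (extDerivOne (oneFormInChart α x₀) y) ≠ 0

/-- A contact structure: a plane field which is the kernel of a contact form. -/
def IsContactStructure (ξ : ∀ x : M, Submodule ℝ (TangentSpace (𝓡 3) x)) : Prop :=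
  ∃ α : OneForm M, IsContactForm α ∧ ∀ x, ξ x = LinearMap.ker (α x).toLinearMap

/-- The flow `φ` generated by `X` is contact: it preserves a contact structure transverse to `X`. -/
def IsContactFlow (X : VField M) (φ : Flow ℝ M) : Prop :=
  ∃ ξ : ∀ x : M, Submodule ℝ (TangentSpace (𝓡 3) x), IsContactStructure ξ ∧
    (∀ x, X x ∉ ξ x) ∧
    ∀ t x, (ξ x).map (dflow φ t x).toLinearMap = ξ (φ t x)

end

end PAFlow

end

/-! The proof makes the normal bundle hyperbolic by rescaling its norm, then lifts the two invariant
lines to the tangent bundle.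

The form `Ω (X, ·, ·)` does not change when multiples of `X` are added to its arguments, so it is an
area form on `TM / ⟨X⟩`. For `s` over `Es` and `u` over `Eu`, `|Ω (X, s, u)| = A x * N s * N u` with
`A` continuous and positive (`exists_continuous_density`). In the norm `√A • N` the product of the
two lengths is therefore invariant under the flow, while domination makes their ratio grow by
`e^{Ct}`. Hence `Es` is contracted by `e^{-Ct/2}` and `Eu` is expanded by `e^{Ct/2}`
(`exists_adapted_norm`).

To lift `Es`, take a continuous 1-form `θ` with `θ X = 1`. On the plane field over `Es`, the
difference between `θ` and its pullback by a time map kills `X`, so it is bounded by the normal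
length, which decays geometrically along orbits. The pullbacks of `θ` converge to an invariant
functional that is 1 on `X`, and its kernel in this plane field is the lift
(`exists_invariant_limit`, `exists_invariant_lift`). The line `Eu` is lifted in the same way with
time reversed. The norm `N ∘ π + |α|`, where `α` is the coordinate along `X`, then shows that the
flow is Anosov (`isAnosov_of_lifts`).

In the contact case, dividing `α` by `α X` gives an invariant contact form, so `α ∧ dα` is an
invariant volume form. The flow is only `C^1`, so naturality of `d` has to be proved without second
derivatives of the time maps (`fderiv_sub_fderiv_of_pullback`).

The flow is given only as continuous, with integral curves of a `C^1` field as orbits. That its time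
maps are `C^1` is proved first (`contMDiff_flow`); the chain rule for the tangent flow depends on
it. -/

noncomputable section
namespace PAFlow
open Set Filter Metric
open scoped NNReal

/-! ### Differentiable dependence on initial conditions in a Banach space. -/

section ODE

variable {E : Type*} [NormedAddCommGroup E] [NormedSpace ℝ E]

/-- A linear differential equation with bounded coefficients has an operator solution on a short
time interval. -/
theorem exists_fundamental_solution [CompleteSpace E] {B : ℝ → E →L[ℝ] E} {K T : ℝ}
    (hT : 0 ≤ T) (hKT : 2 * K * T ≤ 1) (hB : ContinuousOn B (Icc 0 T))
    (hBK : ∀ t ∈ Icc 0 T, ‖B t‖ ≤ K) :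
    ∃ A : ℝ → E →L[ℝ] E, A 0 = ContinuousLinearMap.id ℝ E ∧
      ∀ t ∈ Icc 0 T, HasDerivWithinAt A ((B t).comp (A t)) (Icc 0 T) t := by
  have h0 : (0 : ℝ) ∈ Icc 0 T := ⟨le_rfl, hT⟩
  have hK : 0 ≤ K := (norm_nonneg _).trans (hBK 0 h0)
  -- On the unit ball about the identity operators have norm at most 2, so the speed is at most `2 *
  -- K`, and `2 * K * T ≤ 1` keeps the solution in that ball.
  have hpl : IsPicardLindelof (fun t (A : E →L[ℝ] E) => (B t).comp A) (⟨0, h0⟩ : Icc 0 T)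
      (ContinuousLinearMap.id ℝ E) 1 0 ⟨2 * K, by positivity⟩ ⟨K, hK⟩ := by
    refine ⟨fun t ht => ?_, fun A _ => ?_, fun t ht A hA => ?_, ?_⟩
    · refine LipschitzOnWith.of_dist_le_mul fun A _ A' _ => ?_
      rw [dist_eq_norm, dist_eq_norm, ← ContinuousLinearMap.comp_sub]
      exact (ContinuousLinearMap.opNorm_comp_le _ _).trans
        (mul_le_mul_of_nonneg_right (hBK t ht) (norm_nonneg _))
    · exact hB.clm_comp continuousOn_const
    · have h1 : ‖A‖ ≤ 2 := by
        have h2 : ‖A - ContinuousLinearMap.id ℝ E‖ ≤ 1 := by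
          simpa [dist_eq_norm] using hA
        calc ‖A‖ = ‖(A - ContinuousLinearMap.id ℝ E) + ContinuousLinearMap.id ℝ E‖ := by simp
          _ ≤ ‖A - ContinuousLinearMap.id ℝ E‖ + ‖ContinuousLinearMap.id ℝ E‖ := norm_add_le _ _
          _ ≤ 1 + 1 := add_le_add h2 ContinuousLinearMap.norm_id_le
          _ = 2 := by norm_num
      calc ‖(B t).comp A‖ ≤ ‖B t‖ * ‖A‖ := ContinuousLinearMap.opNorm_comp_le _ _
        _ ≤ K * 2 := mul_le_mul (hBK t ht) h1 (norm_nonneg _) hK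
        _ = _ := by rw [mul_comm]; rfl
    · simp only [sub_zero, sub_self, max_eq_left hT]
      have : (2 * K) * T ≤ (1 : ℝ) - 0 := by simpa using hKT
      exact this
  exact hpl.exists_eq_forall_mem_Icc_hasDerivWithinAt₀

theorem norm_le_gronwallBound_of_hasDerivWithinAt_Icc {u u' : ℝ → E} {δ K ε T : ℝ}
    (hu : ∀ s ∈ Icc 0 T, HasDerivWithinAt u (u' s) (Icc 0 T) s)
    (h0 : ‖u 0‖ ≤ δ) (bound : ∀ s ∈ Icc 0 T, ‖u' s‖ ≤ K * ‖u s‖ + ε) :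
    ∀ s ∈ Icc 0 T, ‖u s‖ ≤ gronwallBound δ K ε s := by
  intro s hs
  have := norm_le_gronwallBound_of_norm_deriv_right_le (a := 0) (b := T)
    (fun s hs => (hu s hs).continuousWithinAt)
    (fun s hs => (hu s (Ico_subset_Icc_self hs)).mono_of_mem_nhdsWithin
      (Icc_mem_nhdsGE_of_mem hs)) h0
    (fun s hs => bound s (Ico_subset_Icc_self hs)) s hs
  simpa using this

/-- The time-`t` map of a local flow of a `C^1` vector field is strictly differentiable for short
positive times. -/
theorem exists_hasStrictFDerivAt_localFlow [CompleteSpace E] {f : E → E} {ψ : ℝ → E → E}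
    {U V : Set E} {K T : ℝ} (hU : IsOpen U) (hV : IsOpen V) (hf : ContDiffOn ℝ 1 f U)
    (hK : 0 < K) (hKT : 2 * K * T ≤ 1) (hfK : ∀ y ∈ U, ‖fderiv ℝ f y‖ ≤ K)
    (h0 : ∀ x ∈ V, ψ 0 x = x)
    (hd : ∀ x ∈ V, ∀ t ∈ Ioo (-T) T, HasDerivAt (fun s => ψ s x) (f (ψ t x)) t)
    (hmem : ∀ x ∈ V, ∀ t ∈ Ioo (-T) T, ψ t x ∈ U)
    (hc : ContinuousOn (fun p : ℝ × E => ψ p.1 p.2) (Ioo (-T) T ×ˢ V))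
    {x₀ : E} (hx₀ : x₀ ∈ V) {t₁ : ℝ} (ht₁ : t₁ ∈ Ico 0 T) :
    ∃ A : E →L[ℝ] E, HasStrictFDerivAt (ψ t₁) A x₀ := by
  have hsub : ∀ t ∈ Icc 0 t₁, t ∈ Ioo (-T) T := fun t ht =>
    ⟨by linarith [ht.1, ht₁.1, ht₁.2], by linarith [ht.2, ht₁.2]⟩
  have hOpen : IsOpen (Ioo (-T) T ×ˢ V) := isOpen_Ioo.prod hV
  have hcAt : ∀ t ∈ Icc 0 t₁, ContinuousAt (fun p : ℝ × E => ψ p.1 p.2) (t, x₀) := fun t ht =>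
    hc.continuousAt (hOpen.mem_nhds ⟨hsub t ht, hx₀⟩)
  have hzAt : ∀ t ∈ Icc 0 t₁, ContinuousAt (fun s => ψ s x₀) t := fun t ht =>
    (hd x₀ hx₀ t (hsub t ht)).continuousAt
  have hDf : ContinuousOn (fderiv ℝ f) U := hf.continuousOn_fderiv_of_isOpen hU le_rfl
  have hDfAt : ∀ y ∈ U, ContinuousAt (fderiv ℝ f) y := fun y hy => hDf.continuousAt (hU.mem_nhds hy)
  -- `B` is the coefficient of the variational equation `A' = B A` along the orbit of `x₀`. Its
  -- solution at time `t₁` will be the strict derivative.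
  set B : ℝ → E →L[ℝ] E := fun t => fderiv ℝ f (ψ t x₀) with hBdef
  have hBAt : ∀ t ∈ Icc 0 t₁, ContinuousAt B t := fun t ht =>
    ContinuousAt.comp (g := fderiv ℝ f) (hDfAt _ (hmem x₀ hx₀ t (hsub t ht))) (hzAt t ht)
  have hBK : ∀ t ∈ Icc 0 t₁, ‖B t‖ ≤ K := fun t ht => hfK _ (hmem x₀ hx₀ t (hsub t ht))
  obtain ⟨A, hA0, hA⟩ := exists_fundamental_solution (K := K) ht₁.1
    (by nlinarith [ht₁.1, ht₁.2]) (fun t ht => (hBAt t ht).continuousWithinAt) hBK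
  refine ⟨A t₁, HasStrictFDerivAt.of_isLittleO (Asymptotics.isLittleO_iff.2 fun c hc0 => ?_)⟩
  set Q : ℝ := Real.exp ((K + 1) * t₁) with hQ
  have hQ0 : 0 < Q := Real.exp_pos _
  set R : ℝ := Real.exp (K * t₁) with hR
  have hR0 : 0 < R := Real.exp_pos _
  -- The two Grönwall estimates below produce the constant `ε * Q / K * R`. The bound `ε ≤ 1` gives
  -- the rate `K + 1` in the first of them.
  obtain ⟨ε, hε0, hε1, hεc⟩ : ∃ ε : ℝ, 0 < ε ∧ ε ≤ 1 ∧ ε * Q / K * R ≤ c := by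
    refine ⟨min 1 (c * K / (Q * R)), by positivity, min_le_left _ _, ?_⟩
    calc min 1 (c * K / (Q * R)) * Q / K * R ≤ (c * K / (Q * R)) * Q / K * R := by
          gcongr; exact min_le_right _ _
      _ = c := by field_simp
  -- Compactness of the time interval gives one neighbourhood of the whole orbit segment on which
  -- `fderiv ℝ f` is within `ε` of `B`.
  have hev1 : ∀ᶠ w in 𝓝 (0 : E), ∀ t ∈ Icc 0 t₁,
      ψ t x₀ + w ∈ U ∧ ‖fderiv ℝ f (ψ t x₀ + w) - B t‖ ≤ ε := by
    refine isCompact_Icc.eventually_forall_of_forall_eventually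
      (P := fun w t => ψ t x₀ + w ∈ U ∧ ‖fderiv ℝ f (ψ t x₀ + w) - B t‖ ≤ ε) fun t ht => ?_
    have hU' : ψ t x₀ + 0 ∈ U := by simpa using hmem x₀ hx₀ t (hsub t ht)
    have h1 : ContinuousAt (fun p : E × ℝ => ψ p.2 x₀ + p.1) (0, t) :=
      (ContinuousAt.comp (g := fun s => ψ s x₀) (f := fun p : E × ℝ => p.2) (hzAt t ht)
        continuousAt_snd).add continuousAt_fst
    have h2 : ContinuousAt (fun p : E × ℝ => fderiv ℝ f (ψ p.2 x₀ + p.1) - B p.2) (0, t) :=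
      (ContinuousAt.comp (g := fderiv ℝ f) (f := fun p : E × ℝ => ψ p.2 x₀ + p.1) (x := (0, t))
        (hDfAt _ hU') h1).sub
        (ContinuousAt.comp (g := B) (f := fun p : E × ℝ => p.2) (hBAt t ht) continuousAt_snd)
    have h3 := h2.norm.eventually_lt (continuousAt_const (y := ε)) (by simpa [hBdef] using hε0)
    filter_upwards [h1.eventually (hU.mem_nhds hU'), h3] with p hp1 hp2
    exact ⟨hp1, hp2.le⟩
  obtain ⟨ρ, hρ, hρ'⟩ := Metric.eventually_nhds_iff_ball.1 hev1
  have hev2 : ∀ᶠ x in 𝓝 x₀, ∀ t ∈ Icc 0 t₁, ψ t x ∈ ball (ψ t x₀) ρ := by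
    refine isCompact_Icc.eventually_forall_of_forall_eventually
      (P := fun x t => ψ t x ∈ ball (ψ t x₀) ρ) fun t ht => ?_
    have h1 : ContinuousAt (fun p : E × ℝ => ψ p.2 p.1) (x₀, t) :=
      ContinuousAt.comp (g := fun p : ℝ × E => ψ p.1 p.2) (f := Prod.swap) (hcAt t ht)
        continuous_swap.continuousAt
    have h2 : ContinuousAt (fun p : E × ℝ => ψ p.2 x₀) (x₀, t) :=
      ContinuousAt.comp (g := fun s => ψ s x₀) (f := fun p : E × ℝ => p.2) (hzAt t ht)
        continuousAt_snd
    exact (h1.dist h2).eventually_lt continuousAt_const (by simpa using hρ)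
  have hlip : ∀ t ∈ Icc 0 t₁, ∀ a ∈ ball (ψ t x₀) ρ, ∀ b ∈ ball (ψ t x₀) ρ,
      ‖f b - f a - B t (b - a)‖ ≤ ε * ‖b - a‖ := by
    intro t ht a ha b hb
    have key : ∀ y ∈ ball (ψ t x₀) ρ, y ∈ U ∧ ‖fderiv ℝ f y - B t‖ ≤ ε := by
      intro y hy
      have := hρ' (y - ψ t x₀) (by simpa [dist_eq_norm] using hy) t ht
      simpa using this
    exact (convex_ball _ _).norm_image_sub_le_of_norm_hasFDerivWithin_le'
      (f' := fderiv ℝ f) (fun y hy =>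
        ((hf.differentiableOn one_ne_zero).differentiableAt
          (hU.mem_nhds (key y hy).1)).hasFDerivAt.hasFDerivWithinAt)
      (fun y hy => (key y hy).2) ha hb
  have hev3 : ∀ᶠ x in 𝓝 x₀, x ∈ V ∧ ∀ t ∈ Icc 0 t₁, ψ t x ∈ ball (ψ t x₀) ρ :=
    (hV.eventually_mem hx₀).and hev2
  rw [nhds_prod_eq]
  filter_upwards [hev3.prod_mk hev3] with p hp
  obtain ⟨⟨hxV, hx⟩, hyV, hy⟩ := hp
  set x := p.1
  set y := p.2
  have ht₁' : t₁ ∈ Icc 0 t₁ := ⟨ht₁.1, le_rfl⟩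
  have hδd : ∀ t ∈ Icc 0 t₁, HasDerivWithinAt (fun s => ψ s x - ψ s y)
      (f (ψ t x) - f (ψ t y)) (Icc 0 t₁) t := fun t ht =>
    ((hd x hxV t (hsub t ht)).sub (hd y hyV t (hsub t ht))).hasDerivWithinAt
  -- First Grönwall estimate: nearby orbits separate at most by the factor `Q`.
  have hδ : ∀ t ∈ Icc 0 t₁, ‖ψ t x - ψ t y‖ ≤ ‖x - y‖ * Q := by
    intro t ht
    have h1 := norm_le_gronwallBound_of_hasDerivWithinAt_Icc (δ := ‖x - y‖) (K := K + 1) (ε := 0)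
      hδd (by simp [h0 x hxV, h0 y hyV]) (fun s hs => ?_) t ht
    · rw [gronwallBound_ε0] at h1
      refine h1.trans ?_
      have := ht.2
      rw [hQ]
      gcongr
    · have h2 := hlip s hs _ (hy s hs) _ (hx s hs)
      have h3 : ‖B s (ψ s x - ψ s y)‖ ≤ K * ‖ψ s x - ψ s y‖ :=
        (B s).le_of_opNorm_le (hBK s hs) _
      calc ‖f (ψ s x) - f (ψ s y)‖
          = ‖(f (ψ s x) - f (ψ s y) - B s (ψ s x - ψ s y)) + B s (ψ s x - ψ s y)‖ := by
            rw [sub_add_cancel]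
        _ ≤ ε * ‖ψ s x - ψ s y‖ + K * ‖ψ s x - ψ s y‖ := (norm_add_le _ _).trans (add_le_add h2 h3)
        _ ≤ 1 * ‖ψ s x - ψ s y‖ + K * ‖ψ s x - ψ s y‖ := by gcongr
        _ = (K + 1) * ‖ψ s x - ψ s y‖ + 0 := by ring
  have hud : ∀ t ∈ Icc 0 t₁, HasDerivWithinAt (fun s => ψ s x - ψ s y - A s (x - y))
      (f (ψ t x) - f (ψ t y) - B t (A t (x - y))) (Icc 0 t₁) t := fun t ht =>
    (hδd t ht).sub (by
      have := (hA t ht).clm_apply (hasDerivWithinAt_const t (Icc 0 t₁) (x - y))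
      simpa using this)
  -- Second Grönwall estimate: the linearisation error starts at 0 and is forced by a term of size
  -- at most `ε * (‖x - y‖ * Q)`.
  have hu := norm_le_gronwallBound_of_hasDerivWithinAt_Icc (δ := 0) (K := K)
    (ε := ε * (‖x - y‖ * Q)) hud (by simp [h0 x hxV, h0 y hyV, hA0]) (fun s hs => by
      have h2 := hlip s hs _ (hy s hs) _ (hx s hs)
      have h3 : ‖B s (ψ s x - ψ s y - A s (x - y))‖ ≤ K * ‖ψ s x - ψ s y - A s (x - y)‖ :=
        (B s).le_of_opNorm_le (hBK s hs) _
      calc ‖f (ψ s x) - f (ψ s y) - B s (A s (x - y))‖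
          = ‖B s (ψ s x - ψ s y - A s (x - y)) +
              (f (ψ s x) - f (ψ s y) - B s (ψ s x - ψ s y))‖ := by
            rw [map_sub (B s) (ψ s x - ψ s y) (A s (x - y))]; congr 1; abel
        _ ≤ K * ‖ψ s x - ψ s y - A s (x - y)‖ + ε * ‖ψ s x - ψ s y‖ :=
            (norm_add_le _ _).trans (add_le_add h3 h2)
        _ ≤ _ := by gcongr; exact hδ s hs) t₁ ht₁'
  rw [gronwallBound_of_K_ne_0 hK.ne'] at hu
  simp only [zero_mul, zero_add] at hu
  calc ‖ψ t₁ x - ψ t₁ y - A t₁ (x - y)‖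
      ≤ ε * (‖x - y‖ * Q) / K * (R - 1) := hu
    _ ≤ ε * (‖x - y‖ * Q) / K * R := by gcongr; linarith
    _ = (ε * Q / K * R) * ‖x - y‖ := by ring
    _ ≤ c * ‖x - y‖ := by gcongr

/-- A function that is strictly differentiable on an open set is `C^1` there. -/
theorem contDiffAt_one_of_hasStrictFDerivAt {F : Type*} [NormedAddCommGroup F] [NormedSpace ℝ F]
    {g : E → F} {V : Set E} (hV : IsOpen V)
    (h : ∀ x ∈ V, ∃ A : E →L[ℝ] F, HasStrictFDerivAt g A x) {x : E} (hx : x ∈ V) :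
    ContDiffAt ℝ 1 g x := by
  have hs : ∀ y ∈ V, HasStrictFDerivAt g (fderiv ℝ g y) y := by
    intro y hy
    obtain ⟨A, hA⟩ := h y hy
    rwa [hA.hasFDerivAt.fderiv]
  refine contDiffAt_one_iff.2 ⟨fderiv ℝ g, V, hV.mem_nhds hx, ?_,
    fun y hy => (hs y hy).hasFDerivAt⟩
  intro y hy
  refine ContinuousAt.continuousWithinAt (Metric.continuousAt_iff'.2 fun ε hε => ?_)
  have h1 := (Asymptotics.isLittleO_iff.1 (hs y hy).isLittleO) (half_pos hε)
  rw [nhds_prod_eq] at h1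
  obtain ⟨pa, hpa, pb, hpb, hab⟩ := Filter.eventually_prod_iff.1 h1
  have h2 : ∀ᶠ z in 𝓝 y, ∀ᶠ w in 𝓝 z, pa w ∧ pb w ∧ w ∈ V :=
    eventually_eventually_nhds.2 (hpa.and (hpb.and (hV.mem_nhds hy)))
  filter_upwards [h2] with z hz
  have hzV : z ∈ V := hz.self_of_nhds.2.2
  -- By strict differentiability `g - Dg(y)` is `ε / 2`-Lipschitz near `y`. This bounds its
  -- derivative `Dg(z) - Dg(y)` at nearby points `z`.
  have hfd : HasFDerivAt (fun w => g w - fderiv ℝ g y w) (fderiv ℝ g z - fderiv ℝ g y) z :=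
    (hs z hzV).hasFDerivAt.sub (fderiv ℝ g y).hasFDerivAt
  rw [dist_eq_norm]
  refine lt_of_le_of_lt (hfd.le_of_lip' (half_pos hε).le ?_) (half_lt_self hε)
  filter_upwards [hz] with w hw
  have := hab hw.1 hz.self_of_nhds.2.1
  calc ‖g w - fderiv ℝ g y w - (g z - fderiv ℝ g y z)‖
      = ‖g w - g z - fderiv ℝ g y (w - z)‖ := by rw [map_sub]; congr 1; abel
    _ ≤ _ := this

end ODE
end PAFlow
end

/-! ### The time maps of the flow on the manifold are `C^1`. -/

noncomputable section
namespace PAFlow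
open Set Filter Metric Bundle

universe u
variable {M : Type u} [TopologicalSpace M] [ChartedSpace E3 M]

/-- A local flow of a `C^1` vector field consists of `C^1` maps for short times. -/
theorem contDiffAt_localFlow {E : Type*} [NormedAddCommGroup E] [NormedSpace ℝ E] [CompleteSpace E]
    {f : E → E} {ψ : ℝ → E → E}
    {U V : Set E} {K T : ℝ} (hU : IsOpen U) (hV : IsOpen V) (hf : ContDiffOn ℝ 1 f U)
    (hK : 0 < K) (hKT : 2 * K * T ≤ 1) (hfK : ∀ y ∈ U, ‖fderiv ℝ f y‖ ≤ K)
    (h0 : ∀ x ∈ V, ψ 0 x = x)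
    (hd : ∀ x ∈ V, ∀ t ∈ Ioo (-T) T, HasDerivAt (fun s => ψ s x) (f (ψ t x)) t)
    (hmem : ∀ x ∈ V, ∀ t ∈ Ioo (-T) T, ψ t x ∈ U)
    (hc : ContinuousOn (fun p : ℝ × E => ψ p.1 p.2) (Ioo (-T) T ×ˢ V))
    {x : E} (hx : x ∈ V) {t : ℝ} (ht : t ∈ Ioo (-T) T) : ContDiffAt ℝ 1 (ψ t) x := by
  refine contDiffAt_one_of_hasStrictFDerivAt hV (fun y hy => ?_) hx
  have hneg : ∀ s ∈ Ioo (-T) T, -s ∈ Ioo (-T) T := fun s hs =>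
    ⟨by linarith [hs.2], by linarith [hs.1]⟩
  rcases le_total 0 t with h | h
  · exact exists_hasStrictFDerivAt_localFlow hU hV hf hK hKT hfK h0 hd hmem hc hy ⟨h, ht.2⟩
  · have hfd : ∀ y, fderiv ℝ (fun z => -f z) y = -fderiv ℝ f y := fun y => fderiv_fun_neg
    -- Negative times reduce to positive ones by reversing time, which replaces `f` by `-f`.
    have := exists_hasStrictFDerivAt_localFlow (ψ := fun s z => ψ (-s) z) (f := fun z => -f z)
      hU hV hf.neg hK hKT (fun y hy => by rw [hfd, norm_neg]; exact hfK y hy)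
      (fun x hx => by simpa using h0 x hx)
      (fun x hx s hs => by
        have h1 := (hd x hx (-s) (hneg s hs)).scomp s (hasDerivAt_neg s)
        rw [neg_one_smul] at h1
        exact h1)
      (fun x hx s hs => hmem x hx _ (hneg s hs))
      (hc.comp (f := fun p : ℝ × E => (-p.1, p.2)) (by fun_prop)
        (fun p hp => ⟨hneg _ hp.1, hp.2⟩)) hy (t₁ := -t) ⟨by linarith, by linarith [ht.1]⟩
    simpa using this

/-- The derivative at `x` of the chart at `x₀`. -/
def chartDeriv (x₀ x : M) : E3 →L[ℝ] E3 :=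
  mfderiv (𝓡 3) 𝓘(ℝ, E3) (extChartAt (𝓡 3) x₀) x

/-- The components of a tangent vector in the chart at `x₀`. -/
def chartVec (x₀ : M) (p : TangentBundle (𝓡 3) M) : E3 :=
  chartDeriv x₀ p.1 p.2

variable [IsManifold (𝓡 3) ∞ M]

/-- Chart components are the fibre coordinates of the tangent bundle trivialization. Through this,
regularity of sections of the tangent bundle passes to their chart expressions. -/
theorem chartVec_eq_trivializationAt {x₀ : M} {p : TangentBundle (𝓡 3) M}
    (hp : p.1 ∈ (extChartAt (𝓡 3) x₀).source) :
    chartVec x₀ p = (trivializationAt E3 (TangentSpace (𝓡 3)) x₀ p).2 := by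
  have : IsManifold (𝓡 3) 1 M := inferInstance
  rw [extChartAt_source] at hp
  have h := TangentBundle.continuousLinearMapAt_trivializationAt (𝕜 := ℝ) (I := 𝓡 3) hp
  have hb : p.1 ∈ (trivializationAt E3 (TangentSpace (𝓡 3) (M := M)) x₀).baseSet := hp
  have h1 : chartVec x₀ p =
      (trivializationAt E3 (TangentSpace (𝓡 3) (M := M)) x₀).continuousLinearMapAt ℝ p.1 p.2 :=
    (congrArg (fun A : E3 →L[ℝ] E3 => A p.2) h).symm
  rw [h1, Trivialization.continuousLinearMapAt_apply, Trivialization.linearMapAt_apply, if_pos hb]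

theorem continuousOn_chartVec (x₀ : M) :
    ContinuousOn (chartVec x₀) {p | p.1 ∈ (extChartAt (𝓡 3) x₀).source} := by
  have h : ContinuousOn (fun p => (trivializationAt E3 (TangentSpace (𝓡 3) (M := M)) x₀ p).2)
      {p | p.1 ∈ (extChartAt (𝓡 3) x₀).source} := by
    refine continuous_snd.comp_continuousOn
      ((trivializationAt E3 (TangentSpace (𝓡 3)) x₀).continuousOn.mono fun p hp => ?_)
    rw [mem_ofPred_eq, extChartAt_source] at hp
    exact (Trivialization.mem_source _).2 hp
  exact h.congr fun p hp => chartVec_eq_trivializationAt hp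

/-- A vector field read in the chart at `x₀`. -/
def chartField (X : VField M) (x₀ : M) (y : E3) : E3 :=
  chartVec x₀ ⟨(extChartAt (𝓡 3) x₀).symm y, X _⟩

theorem contDiffOn_chartField {X : VField M} (hX : IsC1Field X) (x₀ : M) :
    ContDiffOn ℝ 1 (chartField X x₀) (extChartAt (𝓡 3) x₀).target := by
  have : IsManifold (𝓡 3) (1 + 1) M := by
    rw [one_add_one_eq_two]; infer_instance
  have : IsManifold (𝓡 3) 1 M := inferInstance
  rw [← contMDiffOn_iff_contDiffOn]
  have h1 : ContMDiffOn 𝓘(ℝ, E3) (𝓡 3).tangent 1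
      (fun y => (⟨(extChartAt (𝓡 3) x₀).symm y, X _⟩ : TangentBundle (𝓡 3) M))
      (extChartAt (𝓡 3) x₀).target :=
    hX.comp_contMDiffOn (contMDiffOn_extChartAt_symm x₀)
  have h2 := ((trivializationAt E3 (TangentSpace (𝓡 3) (M := M)) x₀).contMDiffOn_iff (fun y hy => by
    refine (Trivialization.mem_source _).2 ?_
    have := (extChartAt (𝓡 3) x₀).map_target hy
    rwa [extChartAt_source] at this)).1 h1
  exact h2.2.congr fun y hy => chartVec_eq_trivializationAt ((extChartAt (𝓡 3) x₀).map_target hy)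

theorem hasDerivAt_extChartAt_flow {X : VField M} {φ : Flow ℝ M} (h : Generates X φ) {x₀ x : M}
    {t : ℝ} (hx : φ t x ∈ (extChartAt (𝓡 3) x₀).source) :
    HasDerivAt (fun s => extChartAt (𝓡 3) x₀ (φ s x))
      (chartField X x₀ (extChartAt (𝓡 3) x₀ (φ t x))) t := by
  have : IsManifold (𝓡 3) 1 M := inferInstance
  have h1 := (mdifferentiableAt_extChartAt (I := 𝓡 3) (x := x₀) (y := φ t x)
    (by rwa [extChartAt_source] at hx)).hasMFDerivAt
  obtain ⟨w, hw⟩ : ∃ w : E3, w = X (φ t x) := ⟨_, rfl⟩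
  have h2 : HasFDerivAt (fun s => extChartAt (𝓡 3) x₀ (φ s x))
      ((chartDeriv x₀ (φ t x)).comp ((1 : ℝ →L[ℝ] ℝ).smulRight w)) t := by
    subst hw
    exact (HasMFDerivAt.comp t h1 (h x t)).hasFDerivAt
  have h3 : chartField X x₀ (extChartAt (𝓡 3) x₀ (φ t x)) = chartDeriv x₀ (φ t x) w := by
    unfold chartField
    rw [(extChartAt (𝓡 3) x₀).left_inv hx, hw]
    rfl
  rw [h3]
  simpa using h2.hasDerivAt

/-- Near every point the flow of a `C^1` vector field is `C^1` for short times. -/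
theorem exists_contMDiffAt_flow {X : VField M} (hX : IsC1Field X) {φ : Flow ℝ M}
    (h : Generates X φ) (x₀ : M) :
    ∃ T > 0, ∀ᶠ x in 𝓝 x₀, ∀ t ∈ Ioo (-T) T, ContMDiffAt (𝓡 3) (𝓡 3) 1 (fun z => φ t z) x := by
  have : IsManifold (𝓡 3) 1 M := inferInstance
  set c := extChartAt (𝓡 3) x₀ with hcdef
  set f := chartField X x₀ with hfdef
  have htgt : IsOpen c.target := isOpen_extChartAt_target x₀
  have hsrc : IsOpen c.source := isOpen_extChartAt_source x₀
  have hf : ContDiffOn ℝ 1 f c.target := contDiffOn_chartField hX x₀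
  -- The added 1 makes the bound on `fderiv ℝ f` strict at `c x₀`, so that it holds on an open set,
  -- and makes `K` positive.
  set K : ℝ := ‖fderiv ℝ f (c x₀)‖ + 1 with hKdef
  have hK : 0 < K := by positivity
  set U : Set E3 := c.target ∩ {y | ‖fderiv ℝ f y‖ < K} with hUdef
  have hU : IsOpen U :=
    (hf.continuousOn_fderiv_of_isOpen htgt le_rfl).norm.isOpen_inter_preimage htgt isOpen_Iio
  have hx₀U : c x₀ ∈ U := ⟨mem_extChartAt_target x₀, by simp [hKdef]⟩
  have hO : IsOpen (c.source ∩ c ⁻¹' U) :=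
    (continuousOn_extChartAt x₀).isOpen_inter_preimage hsrc hU
  have hφc : Continuous fun p : ℝ × M => φ p.1 p.2 := φ.continuous continuous_fst continuous_snd
  have hnear : ∀ᶠ p : ℝ × M in 𝓝 (0, x₀), φ p.1 p.2 ∈ c.source ∩ c ⁻¹' U := by
    refine hφc.continuousAt.eventually (hO.mem_nhds ?_)
    simp only [φ.map_zero_apply]
    exact ⟨mem_extChartAt_source x₀, hx₀U⟩
  rw [nhds_prod_eq] at hnear
  obtain ⟨pa, hpa, pb, hpb, hab⟩ := Filter.eventually_prod_iff.1 hnear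
  obtain ⟨T₀, hT₀, hT₀'⟩ := Metric.eventually_nhds_iff_ball.1 hpa
  obtain ⟨W, hWsub, hWo, hxW⟩ := _root_.eventually_nhds_iff.1 hpb
  -- The first bound keeps orbits starting near `x₀` inside the chart and in `U`; the second gives
  -- `2 * K * T ≤ 1`.
  set T := min T₀ (1 / (2 * K)) with hTdef
  have hT : 0 < T := by positivity
  have hKT : 2 * K * T ≤ 1 := by
    calc 2 * K * T ≤ 2 * K * (1 / (2 * K)) := by gcongr; exact min_le_right _ _
      _ = 1 := by field_simp
  have htime : ∀ t ∈ Ioo (-T) T, pa t := fun t ht => hT₀' t (by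
    rw [Real.ball_eq_Ioo]
    have := min_le_left T₀ (1 / (2 * K))
    exact ⟨by linarith [ht.1], by linarith [ht.2]⟩)
  set V : Set E3 := c.target ∩ c.symm ⁻¹' W with hVdef
  have hV : IsOpen V := (continuousOn_extChartAt_symm x₀).isOpen_inter_preimage htgt hWo
  have hin : ∀ y ∈ V, ∀ t ∈ Ioo (-T) T, φ t (c.symm y) ∈ c.source ∩ c ⁻¹' U :=
    fun y hy t ht => hab (htime t ht) (hWsub _ hy.2)
  refine ⟨T, hT, ?_⟩
  filter_upwards [hWo.mem_nhds hxW, hsrc.mem_nhds (mem_extChartAt_source x₀)] with x hxW hxs t ht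
  have hxV : c x ∈ V := ⟨c.map_source hxs, by simpa [c.left_inv hxs] using hxW⟩
  have hφx := hin (c x) hxV t ht
  rw [c.left_inv hxs] at hφx
  have hmain : ContDiffAt ℝ 1 (fun y => c (φ t (c.symm y))) (c x) := by
    refine contDiffAt_localFlow (ψ := fun t y => c (φ t (c.symm y))) (f := f) (K := K)
      hU hV (hf.mono inter_subset_left) hK hKT (fun y hy => hy.2.le) (fun y hy => ?_)
      (fun y hy s hs => hasDerivAt_extChartAt_flow h (hin y hy s hs).1)
      (fun y hy s hs => (hin y hy s hs).2) ?_ hxV ht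
    · simp only [φ.map_zero_apply]
      exact c.right_inv hy.1
    · refine (continuousOn_extChartAt x₀).comp (f := fun p : ℝ × E3 => φ p.1 (c.symm p.2)) ?_
        (fun p hp => (hin p.2 hp.2 p.1 hp.1).1)
      refine hφc.comp_continuousOn (f := fun p : ℝ × E3 => (p.1, c.symm p.2))
        (continuousOn_fst.prodMk ?_)
      exact (continuousOn_extChartAt_symm x₀).comp continuousOn_snd (fun p hp => hp.2.1)
  rw [hcdef, extChartAt_source] at hxs
  have hφs := hφx.1
  rw [hcdef, extChartAt_source] at hφs
  rw [contMDiffAt_iff_of_mem_source hxs hφs]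
  exact ⟨(φ.continuous continuous_const continuous_id).continuousAt, hmain.contDiffWithinAt⟩

/-- The flow of a `C^1` vector field on a compact manifold consists of `C^1` maps. -/
theorem contMDiff_flow [CompactSpace M] {X : VField M} (hX : IsC1Field X) {φ : Flow ℝ M}
    (h : Generates X φ) (t : ℝ) : ContMDiff (𝓡 3) (𝓡 3) 1 (fun z => φ t z) := by
  obtain ⟨T, hT, hTall⟩ : ∃ T > 0, ∀ t ∈ Ioo (-T) T,
      ContMDiff (𝓡 3) (𝓡 3) 1 (fun z => φ t z) := by
    choose T hT hTn using fun x₀ : M => exists_contMDiffAt_flow hX h x₀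
    obtain ⟨s, -, hs⟩ := isCompact_univ.elim_nhds_subcover (X := M)
      (fun x₀ => {x | ∀ t ∈ Ioo (-T x₀) (T x₀), ContMDiffAt (𝓡 3) (𝓡 3) 1 (fun z => φ t z) x})
      (fun x₀ _ => hTn x₀)
    obtain ⟨T', hT', hle⟩ : ∃ T' > 0, ∀ x ∈ s, T' ≤ T x := by
      rcases s.eq_empty_or_nonempty with rfl | hne
      · exact ⟨1, one_pos, by simp⟩
      · exact ⟨s.inf' hne T, (Finset.lt_inf'_iff hne).2 fun x _ => hT x,
          fun x hx => Finset.inf'_le _ hx⟩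
    refine ⟨T', hT', fun t ht x => ?_⟩
    obtain ⟨x₀, hx₀, hx⟩ := mem_iUnion₂.1 (hs (mem_univ x))
    exact hx t ⟨by linarith [hle x₀ hx₀, ht.1], by linarith [hle x₀ hx₀, ht.2]⟩
  have hn : ∀ n : ℕ, ∀ t ∈ Ioo (-T) T, ContMDiff (𝓡 3) (𝓡 3) 1 (fun z => φ (n * t) z) := by
    intro n t ht
    induction n with
    | zero => 
      have : (fun z => φ ((0 : ℕ) * t) z) = (id : M → M) := by
        funext z
        simp
      rw [this]
      exact contMDiff_id
    | succ n ih =>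
      have : (fun z => φ ((n + 1 : ℕ) * t) z) = (fun z => φ (n * t) z) ∘ fun z => φ t z := by
        funext z
        rw [Function.comp_apply, ← φ.map_add]
        congr 1
        push_cast
        ring
      rw [this]
      exact ih.comp (hTall t ht)
  -- An arbitrary time is cut into `n` steps shorter than the uniform time `T`.
  obtain ⟨n, hn'⟩ := exists_nat_gt (|t| / T)
  have hn0 : (0 : ℝ) < n := lt_of_le_of_lt (by positivity) hn'
  have : t = n * (t / n) := by field_simp
  rw [this]
  refine hn n _ (abs_lt.1 ?_)
  rw [abs_div, Nat.abs_cast, div_lt_iff₀ hn0, mul_comm]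
  exact (div_lt_iff₀ hT).1 hn'

end PAFlow
end

/-! ### Limits of a function along contracted orbits. -/

noncomputable section
namespace PAFlow
open Set Filter Metric Bundle

/-- If `θ` varies along the orbits of a flow by at most a constant times `N`, and `N` is contracted
on the invariant set `W`, then the limits of `θ` along the orbits in `W` form a continuous
invariant function. -/
theorem exists_invariant_limit {T : Type*} [TopologicalSpace T] {Φ : ℝ → T → T}
    (hadd : ∀ s t p, Φ (s + t) p = Φ s (Φ t p)) (h0 : ∀ p, Φ 0 p = p)
    (hc : ∀ t, Continuous (Φ t)) {W : Set T} (hW : ∀ t, ∀ p ∈ W, Φ t p ∈ W) {N θ : T → ℝ}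
    (hN : Continuous N) (hθ : Continuous θ)
    (hK : ∀ t, ∃ K, 0 ≤ K ∧ ∀ p ∈ W, |θ (Φ t p) - θ p| ≤ K * N p) {τ r : ℝ} (hr0 : 0 ≤ r) (hr : r < 1)
    (hNr : ∀ p ∈ W, N (Φ τ p) ≤ r * N p) :
    ∃ A : T → ℝ, ContinuousOn A W ∧
      (∀ p ∈ W, Tendsto (fun n : ℕ => θ (Φ (n * τ) p)) atTop (𝓝 (A p))) ∧
      ∀ t, ∀ p ∈ W, A (Φ t p) = A p := by
  have hsucc : ∀ (n : ℕ) p, Φ ((n + 1 : ℕ) * τ) p = Φ τ (Φ (n * τ) p) := by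
    intro n p
    rw [← hadd]
    congr 1
    push_cast
    ring
  have hNn : ∀ (n : ℕ), ∀ p ∈ W, N (Φ (n * τ) p) ≤ r ^ n * N p := by
    intro n p hp
    induction n with
    | zero => simp [h0]
    | succ n ih =>
      rw [hsucc]
      calc N (Φ τ (Φ (n * τ) p)) ≤ r * N (Φ (n * τ) p) := hNr _ (hW _ _ hp)
        _ ≤ r * (r ^ n * N p) := by gcongr
        _ = r ^ (n + 1) * N p := by ring
  obtain ⟨K, hK0, hKτ⟩ := hK τ
  -- The increments of `θ` along the orbit are dominated by a geometric sequence, since each is at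
  -- most `K` times the current value of `N`.
  have hdist : ∀ p ∈ W, ∀ n : ℕ,
      dist (θ (Φ (n * τ) p)) (θ (Φ ((n + 1 : ℕ) * τ) p)) ≤ K * N p * r ^ n := by
    intro p hp n
    rw [hsucc, dist_comm, Real.dist_eq]
    calc _ ≤ K * N (Φ (n * τ) p) := hKτ _ (hW _ _ hp)
      _ ≤ K * (r ^ n * N p) := by gcongr; exact hNn n p hp
      _ = _ := by ring
  have hex : ∀ p, ∃ a, p ∈ W → Tendsto (fun n : ℕ => θ (Φ (n * τ) p)) atTop (𝓝 a) := by
    intro p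
    by_cases hp : p ∈ W
    · obtain ⟨a, ha⟩ := cauchySeq_tendsto_of_complete
        (cauchySeq_of_le_geometric r (K * N p) hr (hdist p hp))
      exact ⟨a, fun _ => ha⟩
    · exact ⟨0, fun h => absurd h hp⟩
  choose A hA using hex
  refine ⟨A, ?_, hA, fun t p hp => ?_⟩
  · have hlu : TendstoLocallyUniformlyOn (fun (n : ℕ) p => θ (Φ (n * τ) p)) A atTop W := by
      rw [Metric.tendstoLocallyUniformlyOn_iff]
      intro ε hε p hp
      have hlim : Tendsto (fun n : ℕ => K * (N p + 1) * r ^ n / (1 - r)) atTop (𝓝 0) := by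
        simpa using ((tendsto_pow_atTop_nhds_zero_of_lt_one hr0 hr).const_mul
          (K * (N p + 1))).div_const (1 - r)
      refine ⟨W ∩ {q | N q < N p + 1}, inter_mem_nhdsWithin _
        ((isOpen_lt hN continuous_const).mem_nhds (lt_add_one (N p))), ?_⟩
      filter_upwards [hlim.eventually_lt_const hε] with n hn q hq
      rw [dist_comm]
      refine lt_of_le_of_lt ?_ hn
      refine (dist_le_of_le_geometric_of_tendsto r (K * N q) hr (hdist q hq.1) (hA q hq.1) n).trans ?_
      have h1r : 0 < 1 - r := by linarith
      have : N q ≤ N p + 1 := le_of_lt hq.2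
      gcongr
    exact hlu.continuousOn (Eventually.frequently (Eventually.of_forall fun n =>
      (hθ.comp (hc _)).continuousOn))
  · have h1 : Tendsto (fun n : ℕ => θ (Φ (n * τ) (Φ t p)) - θ (Φ (n * τ) p)) atTop
        (𝓝 (A (Φ t p) - A p)) := (hA _ (hW t p hp)).sub (hA p hp)
    -- The maps commute, so the two sequences compare `θ` at `q` and at `Φ t q` with `q = Φ (n * τ)
    -- p`. The gap is at most `K' * N q`, which tends to 0.
    have h2 : Tendsto (fun n : ℕ => θ (Φ (n * τ) (Φ t p)) - θ (Φ (n * τ) p)) atTop (𝓝 0) := by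
      obtain ⟨K', hK0', hK'⟩ := hK t
      have hlim : Tendsto (fun n : ℕ => K' * (r ^ n * N p)) atTop (𝓝 0) := by
        simpa using ((tendsto_pow_atTop_nhds_zero_of_lt_one hr0 hr).mul_const (N p)).const_mul K'
      refine squeeze_zero_norm (fun n => ?_) hlim
      rw [Real.norm_eq_abs, ← hadd, add_comm, hadd]
      calc _ ≤ K' * N (Φ (n * τ) p) := hK' _ (hW _ _ hp)
        _ ≤ _ := by gcongr; exact hNn n p hp
    exact sub_eq_zero.1 (tendsto_nhds_unique h1 h2)

end PAFlow
end

/-! ### Continuity of covectors and 3-forms tested on frames. -/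

noncomputable section
namespace PAFlow
open Set Filter Metric Bundle

universe u
variable {M : Type u} [TopologicalSpace M] [ChartedSpace E3 M]

/-- The derivative at `y` of the inverse of the chart at `x₀`. -/
def chartSymmDeriv (x₀ : M) (y : E3) : E3 →L[ℝ] E3 :=
  mfderiv 𝓘(ℝ, E3) (𝓡 3) (extChartAt (𝓡 3) x₀).symm y

variable [IsManifold (𝓡 3) ∞ M]

theorem chartSymmDeriv_chartDeriv {x₀ x : M} (hx : x ∈ (extChartAt (𝓡 3) x₀).source) (v : E3) :
    chartSymmDeriv x₀ (extChartAt (𝓡 3) x₀ x) (chartDeriv x₀ x v) = v := by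
  have : IsManifold (𝓡 3) 1 M := inferInstance
  have h := mfderivWithin_extChartAt_symm_comp_mfderiv_extChartAt' (I := 𝓡 3) hx
  rw [ModelWithCorners.range_eq_univ, mfderivWithin_univ] at h
  exact congrArg (fun A : E3 →L[ℝ] E3 => A v) h

theorem chartDeriv_chartSymmDeriv {x₀ : M} {y : E3} (hy : y ∈ (extChartAt (𝓡 3) x₀).target)
    (v : E3) : chartDeriv x₀ ((extChartAt (𝓡 3) x₀).symm y) (chartSymmDeriv x₀ y v) = v := by
  have : IsManifold (𝓡 3) 1 M := inferInstance
  have h := mfderiv_extChartAt_comp_mfderivWithin_extChartAt_symm (I := 𝓡 3) hy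
  rw [ModelWithCorners.range_eq_univ, mfderivWithin_univ] at h
  exact congrArg (fun A : E3 →L[ℝ] E3 => A v) h

theorem chartDeriv_injective {x₀ x : M} (hx : x ∈ (extChartAt (𝓡 3) x₀).source) :
    Function.Injective (chartDeriv x₀ x) :=
  Function.LeftInverse.injective (chartSymmDeriv_chartDeriv hx)

/-- A field of covectors is continuous if its values on a continuous frame are. -/
theorem continuousOn_of_frame {x₀ : M} {U : Set M} (hU : U ⊆ (extChartAt (𝓡 3) x₀).source)
    {e : Fin 3 → VField M}
    (he : ∀ i, ContinuousOn (fun x => (⟨x, e i x⟩ : TangentBundle (𝓡 3) M)) U)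
    (hli : ∀ x ∈ U, LinearIndependent ℝ (fun i => e i x))
    (f : ∀ x : M, TangentSpace (𝓡 3) x →ₗ[ℝ] ℝ)
    (hf : ∀ i, ContinuousOn (fun x => f x (e i x)) U) :
    ContinuousOn (fun p : TangentBundle (𝓡 3) M => f p.1 p.2) {p | p.1 ∈ U} := by
  let E : Fin 3 → M → E3 := e
  -- `A x` is the matrix of the frame in the chart. Inversion is continuous at invertible operators,
  -- so the coordinates of a vector in the frame depend continuously on it, and they express `f`
  -- through its values on the frame.
  set A : M → (Fin 3 → ℝ) →L[ℝ] E3 := fun x =>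
    ∑ i, (ContinuousLinearMap.proj (R := ℝ) (φ := fun _ : Fin 3 => ℝ) i).smulRight
      (chartDeriv x₀ x (E i x)) with hA
  have hAapp : ∀ x s, A x s = chartDeriv x₀ x (∑ i, s i • E i x) := by
    intro x s
    simp [hA]
  have hAc : ContinuousOn A U := by
    refine continuousOn_finsetSum _ fun i _ => ?_
    have h1 : ContinuousOn (fun x => chartVec x₀ ⟨x, e i x⟩) U :=
      (continuousOn_chartVec x₀).comp (he i) (fun x hx => hU hx)
    exact ((ContinuousLinearMap.smulRightL ℝ (Fin 3 → ℝ) E3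
      (ContinuousLinearMap.proj i)).continuous).comp_continuousOn h1
  have hinj : ∀ x ∈ U, Function.Injective (A x) := by
    intro x hx
    refine (injective_iff_map_eq_zero _).2 fun s hs => ?_
    rw [hAapp, map_eq_zero_iff _ (chartDeriv_injective (hU hx))] at hs
    exact funext fun i => Fintype.linearIndependent_iff.1 (hli x hx) s hs i
  have hequiv : ∀ x ∈ U, ∃ B : (Fin 3 → ℝ) ≃L[ℝ] E3, (B : (Fin 3 → ℝ) →L[ℝ] E3) = A x := by
    intro x hx
    refine ⟨(LinearEquiv.ofInjectiveOfFinrankEq (A x).toLinearMap (hinj x hx)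
      (by simp)).toContinuousLinearEquiv, ?_⟩
    ext s
    rfl
  have hinv : ContinuousOn (fun x => (A x).inverse) U := by
    intro x hx
    obtain ⟨B, hB⟩ := hequiv x hx
    have h1 : ContinuousAt (ContinuousLinearMap.inverse : ((Fin 3 → ℝ) →L[ℝ] E3) → _) (A x) := by
      rw [← hB]
      exact (contDiffAt_map_inverse (n := 1) B).continuousAt
    exact ContinuousAt.comp_continuousWithinAt (f := A) h1 (hAc x hx)
  have hproj : ContinuousOn (fun p : TangentBundle (𝓡 3) M => p.1) {p | p.1 ∈ U} :=
    (FiberBundle.continuous_proj E3 (TangentSpace (𝓡 3) (M := M))).continuousOn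
  have hmaps : MapsTo (fun p : TangentBundle (𝓡 3) M => p.1) {p | p.1 ∈ U} U := fun p hp => hp
  have hcoord : ContinuousOn (fun p : TangentBundle (𝓡 3) M => (A p.1).inverse (chartVec x₀ p))
      {p | p.1 ∈ U} :=
    (hinv.comp hproj hmaps).clm_apply ((continuousOn_chartVec x₀).mono fun p hp => hU hp)
  have hsum : ContinuousOn (fun p : TangentBundle (𝓡 3) M =>
      ∑ i, (A p.1).inverse (chartVec x₀ p) i * f p.1 (e i p.1)) {p | p.1 ∈ U} :=
    continuousOn_finsetSum _ fun i _ =>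
      ((continuous_apply i).comp_continuousOn hcoord).mul ((hf i).comp hproj hmaps)
  refine hsum.congr fun p hp => ?_
  obtain ⟨B, hB⟩ := hequiv p.1 hp
  have h1 : A p.1 ((A p.1).inverse (chartVec x₀ p)) = chartVec x₀ p := by
    rw [← hB, ContinuousLinearMap.inverse_equiv]
    exact B.apply_symm_apply _
  rw [hAapp] at h1
  have h2 : p.2 = ∑ i, (A p.1).inverse (chartVec x₀ p) i • e i p.1 :=
    (chartDeriv_injective (hU hp) h1).symm
  calc f p.1 p.2 = f p.1 (∑ i, (A p.1).inverse (chartVec x₀ p) i • e i p.1) := congrArg _ h2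
    _ = _ := by simp [map_sum]

theorem continuous_of_local_frame (f : ∀ x : M, TangentSpace (𝓡 3) x →ₗ[ℝ] ℝ)
    (h : ∀ x₀ : M, ∃ U ∈ 𝓝 x₀, ∃ e : Fin 3 → VField M,
      (∀ i, ContinuousOn (fun x => (⟨x, e i x⟩ : TangentBundle (𝓡 3) M)) U) ∧
      (∀ x ∈ U, LinearIndependent ℝ (fun i => e i x)) ∧
      ∀ i, ContinuousOn (fun x => f x (e i x)) U) :
    Continuous (fun p : TangentBundle (𝓡 3) M => f p.1 p.2) := by
  refine continuous_iff_continuousAt.2 fun p => ?_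
  obtain ⟨U, hU, e, he, hli, hf⟩ := h p.1
  have h1 := continuousOn_of_frame (x₀ := p.1) (U := U ∩ (extChartAt (𝓡 3) p.1).source)
    inter_subset_right (fun i => (he i).mono inter_subset_left) (fun x hx => hli x hx.1) f
    (fun i => (hf i).mono inter_subset_left)
  refine h1.continuousAt ?_
  exact (FiberBundle.continuous_proj E3 (TangentSpace (𝓡 3) (M := M))).continuousAt.preimage_mem_nhds
    (inter_mem hU (extChartAt_source_mem_nhds p.1))

theorem threeForm_eq_inChart (Ω : ThreeForm M) {x₀ x : M}
    (hx : x ∈ (extChartAt (𝓡 3) x₀).source) (v : Fin 3 → E3) :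
    Ω x v = threeFormInChart Ω x₀ (extChartAt (𝓡 3) x₀ x) (fun i => chartDeriv x₀ x (v i)) := by
  have h1 : ∀ z : M, z = x → (Ω z : E3 [⋀^Fin 3]→L[ℝ] ℝ) v = (Ω x : E3 [⋀^Fin 3]→L[ℝ] ℝ) v := by
    rintro z rfl; rfl
  have h2 : threeFormInChart Ω x₀ (extChartAt (𝓡 3) x₀ x) (fun i => chartDeriv x₀ x (v i)) =
      (Ω ((extChartAt (𝓡 3) x₀).symm (extChartAt (𝓡 3) x₀ x)) : E3 [⋀^Fin 3]→L[ℝ] ℝ)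
        (fun i => chartSymmDeriv x₀ (extChartAt (𝓡 3) x₀ x) (chartDeriv x₀ x (v i))) := rfl
  rw [h2]
  simp only [chartSymmDeriv_chartDeriv hx]
  exact (h1 _ ((extChartAt (𝓡 3) x₀).left_inv hx)).symm

/-- The value of a continuous `3`-form on continuous vector fields is continuous. -/
theorem continuousOn_threeForm_apply {Ω : ThreeForm M} (hΩ : IsC0VolumeForm Ω) {x₀ : M} {U : Set M}
    (hU : U ⊆ (extChartAt (𝓡 3) x₀).source) {e : Fin 3 → VField M}
    (he : ∀ i, ContinuousOn (fun x => (⟨x, e i x⟩ : TangentBundle (𝓡 3) M)) U) :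
    ContinuousOn (fun x => Ω x (fun i => e i x)) U := by
  have h1 : ContinuousOn (fun x => threeFormInChart Ω x₀ (extChartAt (𝓡 3) x₀ x)) U :=
    (hΩ.1 x₀).comp ((continuousOn_extChartAt x₀).mono hU)
      (fun x hx => (extChartAt (𝓡 3) x₀).map_source (hU hx))
  have h2 : ContinuousOn (fun x => fun i => chartVec x₀ ⟨x, e i x⟩) U :=
    continuousOn_pi.2 fun i => (continuousOn_chartVec x₀).comp (he i) (fun x hx => hU hx)
  have h3 : ContinuousOn (fun x => threeFormInChart Ω x₀ (extChartAt (𝓡 3) x₀ x)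
      (fun i => chartVec x₀ ⟨x, e i x⟩)) U := h1.eval h2
  exact h3.congr fun x hx => threeForm_eq_inChart Ω (hU hx) _

end PAFlow
end

/-! ### The tangent flow and a continuous 1-form normalised on the generator. -/

noncomputable section
namespace PAFlow
open Set Filter Metric Bundle

universe u
variable {M : Type u} [TopologicalSpace M] [ChartedSpace E3 M]

/-- A property depending monotonically on a constant holds with one constant on a compact space as
soon as it does so locally. -/
theorem exists_forall_of_locally {Y : Type*} [TopologicalSpace Y] [CompactSpace Y]
    {P : ℝ → Y → Prop} (hmono : ∀ K K' x, K ≤ K' → P K x → P K' x)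
    (h : ∀ x₀, ∃ K, ∀ᶠ x in 𝓝 x₀, P K x) : ∃ K, 0 ≤ K ∧ ∀ x, P K x := by
  have := isCompact_univ.induction_on (X := Y) (p := fun s => ∃ K, 0 ≤ K ∧ ∀ x ∈ s, P K x)
    ⟨0, le_rfl, by simp⟩ (fun s t hst ⟨K, hK, hP⟩ => ⟨K, hK, fun x hx => hP x (hst hx)⟩)
    (fun s t ⟨K, hK, hP⟩ ⟨K', hK', hP'⟩ => ⟨max K K', le_max_of_le_left hK, fun x hx => by
      rcases hx with hx | hx
      · exact hmono _ _ x (le_max_left _ _) (hP x hx)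
      · exact hmono _ _ x (le_max_right _ _) (hP' x hx)⟩)
    (fun x₀ _ => by
      obtain ⟨K, hK⟩ := h x₀
      exact ⟨_, mem_nhdsWithin_of_mem_nhds hK, max K 0, le_max_right _ _,
        fun x hx => hmono _ _ x (le_max_left _ _) hx⟩)
  simpa using this

theorem normalProj_eq_zero_iff {X : VField M} {x : M} {w : TangentSpace (𝓡 3) x} :
    normalProj X x w = 0 ↔ ∃ c : ℝ, w = c • X x := by
  rw [normalProj, Submodule.mkQ_apply, Submodule.Quotient.mk_eq_zero,
    Submodule.mem_span_singleton]
  exact exists_congr fun c => eq_comm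

theorem exists_eq_smul_add_smul {X : VField M} {x : M} {e w : TangentSpace (𝓡 3) x}
    (h : normalProj X x w ∈ Submodule.span ℝ {normalProj X x e}) :
    ∃ a c : ℝ, w = a • e + c • X x := by
  obtain ⟨a, ha⟩ := Submodule.mem_span_singleton.1 h
  obtain ⟨c, hc⟩ : ∃ c : ℝ, w - a • e = c • X x := by
    rw [← normalProj_eq_zero_iff, map_sub, map_smul, ha, sub_self]
  exact ⟨a, c, by rw [← hc]; abel⟩

/-- The tangent flow, as a family of maps of the total space of the tangent bundle. -/
def tflow (φ : Flow ℝ M) (t : ℝ) : TangentBundle (𝓡 3) M → TangentBundle (𝓡 3) M :=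
  tangentMap (𝓡 3) (𝓡 3) (fun z => φ t z)

theorem tflow_mk (φ : Flow ℝ M) (t : ℝ) (x : M) (v : TangentSpace (𝓡 3) x) :
    tflow φ t ⟨x, v⟩ = ⟨φ t x, dflow φ t x v⟩ := rfl

variable [IsManifold (𝓡 3) ∞ M] [CompactSpace M] {X : VField M} {φ : Flow ℝ M}

theorem mdifferentiable_flow (hX : IsC1Field X) (h : Generates X φ) (t : ℝ) :
    MDifferentiable (𝓡 3) (𝓡 3) (fun z => φ t z) :=
  (contMDiff_flow hX h t).mdifferentiable one_ne_zero

theorem continuous_tflow (hX : IsC1Field X) (h : Generates X φ) (t : ℝ) :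
    Continuous (tflow φ t) := by
  have : IsManifold (𝓡 3) 1 M := inferInstance
  exact (contMDiff_flow hX h t).continuous_tangentMap le_rfl

omit [IsManifold (𝓡 3) ∞ M] [CompactSpace M] in
theorem tflow_zero (p : TangentBundle (𝓡 3) M) : tflow φ 0 p = p := by
  have : (fun z => φ 0 z) = (id : M → M) := by
    funext z
    simp
  rw [tflow, this, tangentMap_id]
  rfl

/-- This is the chain rule, for which the time maps must be differentiable: elsewhere `mfderiv` has
the default value 0. -/
theorem tflow_add (hX : IsC1Field X) (h : Generates X φ) (s t : ℝ) (p : TangentBundle (𝓡 3) M) :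
    tflow φ (s + t) p = tflow φ s (tflow φ t p) := by
  have : (fun z => φ (s + t) z) = (fun z => φ s z) ∘ fun z => φ t z := by
    funext z
    exact φ.map_add _ _ _
  rw [tflow, this]
  exact tangentMap_comp_at p (mdifferentiable_flow hX h s _) (mdifferentiable_flow hX h t _)

/-- The time-`t` map carries the orbit of `x` to the orbit of `φ t x`, because the time maps
commute. Comparing the velocities at time 0 gives the claim. -/
theorem dflow_generator (hX : IsC1Field X) (h : Generates X φ) (t : ℝ) (x : M) :
    dflow φ t x (X x) = X (φ t x) := by
  have h1 : HasMFDerivAt 𝓘(ℝ, ℝ) (𝓡 3) (fun s : ℝ => φ s x) 0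
      ((1 : ℝ →L[ℝ] ℝ).smulRight (X (φ 0 x))) := h x 0
  have h2 : HasMFDerivAt 𝓘(ℝ, ℝ) (𝓡 3) (fun s : ℝ => φ s (φ t x)) 0
      ((1 : ℝ →L[ℝ] ℝ).smulRight (X (φ 0 (φ t x)))) := h (φ t x) 0
  have h3 := HasMFDerivAt.comp (0 : ℝ) (mdifferentiable_flow hX h t (φ 0 x)).hasMFDerivAt h1
  have he : ((fun z : M => φ t z) ∘ fun s : ℝ => φ s x) = fun s : ℝ => φ s (φ t x) := by
    funext s
    simp only [Function.comp_apply]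
    rw [← φ.map_add, ← φ.map_add, add_comm]
  rw [he] at h3
  have h4 := congrArg (fun A => A (1 : ℝ)) (hasMFDerivAt_unique h3 h2)
  have e1 : ∀ y : M, y = x →
      (mfderiv (𝓡 3) (𝓡 3) (fun z : M => φ t z) y (X y) : E3) =
        mfderiv (𝓡 3) (𝓡 3) (fun z : M => φ t z) x (X x) := by
    rintro y rfl; rfl
  have e2 : ∀ y : M, y = φ t x → (X y : E3) = X (φ t x) := by
    rintro y rfl; rfl
  have h5 : (mfderiv (𝓡 3) (𝓡 3) (fun z : M => φ t z) (φ 0 x) (((1 : ℝ →L[ℝ] ℝ) 1) • X (φ 0 x))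
      : E3) = ((1 : ℝ →L[ℝ] ℝ) 1) • X (φ 0 (φ t x)) := h4
  simp only [one_apply_eq_self, one_smul] at h5
  exact (e1 _ (φ.map_zero_apply x)).symm.trans (h5.trans (e2 _ (φ.map_zero_apply _)))

/-- A field of subspaces mapped into itself by the tangent flow is invariant. -/
theorem map_dflow_eq_of_forall_mem (hX : IsC1Field X) (h : Generates X φ)
    {E : ∀ x : M, Submodule ℝ (TangentSpace (𝓡 3) x)}
    (hE : ∀ t x, ∀ v ∈ E x, dflow φ t x v ∈ E (φ t x)) (t : ℝ) (x : M) :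
    (E x).map (dflow φ t x).toLinearMap = E (φ t x) := by
  refine le_antisymm (Submodule.map_le_iff_le_comap.2 fun v hv => hE t x v hv) fun w hw => ?_
  have h1 : ∀ p : TangentBundle (𝓡 3) M, p.2 ∈ E p.1 → ∀ s, (tflow φ s p).2 ∈ E (tflow φ s p).1 :=
    fun p hp s => hE s p.1 p.2 hp
  -- Surjectivity comes from the inclusion at time `-t`: the vector `w` is the image of its own
  -- pullback, which lies in `E x`.
  have h2 := h1 ⟨φ t x, w⟩ hw (-t)
  have h3 : tflow φ t (tflow φ (-t) ⟨φ t x, w⟩) = ⟨φ t x, w⟩ := by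
    rw [← tflow_add hX h, add_neg_cancel, tflow_zero]
  have h4 : (tflow φ (-t) (⟨φ t x, w⟩ : TangentBundle (𝓡 3) M)).1 = x := by
    change φ (-t) (φ t x) = x
    rw [← φ.map_add, neg_add_cancel, φ.map_zero_apply]
  generalize tflow φ (-t) (⟨φ t x, w⟩ : TangentBundle (𝓡 3) M) = p at h2 h3 h4
  obtain ⟨y, v⟩ := p
  obtain rfl : y = x := h4
  rw [tflow_mk] at h3
  exact ⟨v, h2, TotalSpace.mk_injective _ h3⟩

omit [CompactSpace M] in
/-- There is a continuous `1`-form equal to `1` on a given nowhere-vanishing vector field. -/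
theorem exists_continuous_oneForm [T2Space M] [CompactSpace M] (hX : IsC1Field X)
    (hX0 : ∀ x, X x ≠ 0) :
    ∃ θ : OneForm M, Continuous (fun p : TangentBundle (𝓡 3) M => θ p.1 p.2) ∧
      ∀ x, θ x (X x) = 1 := by
  obtain ⟨ρ, hρ⟩ := PartitionOfUnity.exists_isSubordinate (X := M) isClosed_univ
    (fun x₀ : M => (extChartAt (𝓡 3) x₀).source) (fun x₀ => isOpen_extChartAt_source x₀)
    (fun x _ => mem_iUnion.2 ⟨x, mem_extChartAt_source x⟩)
  set cX : M → M → E3 := fun x₀ x => chartVec x₀ ⟨x, X x⟩ with hcX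
  have hcX0 : ∀ x₀ x, x ∈ (extChartAt (𝓡 3) x₀).source → cX x₀ x ≠ 0 := fun x₀ x hx h0 =>
    hX0 x (chartDeriv_injective hx (h0.trans (map_zero (chartDeriv x₀ x)).symm))
  have hcXc : ∀ x₀, ContinuousOn (cX x₀) (extChartAt (𝓡 3) x₀).source := fun x₀ =>
    (continuousOn_chartVec x₀).comp hX.continuous.continuousOn (fun x hx => hx)
  -- In one chart, `v ↦ ⟨X, v⟩ / ⟨X, X⟩` is a covector equal to 1 on `X`. Averages keep this
  -- normalisation, so a partition of unity glues the local choices.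
  set g : M → TangentBundle (𝓡 3) M → ℝ := fun x₀ p =>
    inner ℝ (cX x₀ p.1) (chartVec x₀ p) / inner ℝ (cX x₀ p.1) (cX x₀ p.1) with hg
  have hproj : Continuous (fun p : TangentBundle (𝓡 3) M => p.1) :=
    FiberBundle.continuous_proj E3 (TangentSpace (𝓡 3) (M := M))
  have hgc : ∀ x₀, ContinuousOn (g x₀) {p | p.1 ∈ (extChartAt (𝓡 3) x₀).source} := by
    intro x₀
    have h1 : ContinuousOn (fun p : TangentBundle (𝓡 3) M => cX x₀ p.1)
        {p | p.1 ∈ (extChartAt (𝓡 3) x₀).source} :=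
      (hcXc x₀).comp hproj.continuousOn (fun p hp => hp)
    exact (h1.inner (𝕜 := ℝ) (continuousOn_chartVec x₀)).div (h1.inner (𝕜 := ℝ) h1)
      (fun p hp => inner_self_ne_zero.2 (hcX0 x₀ p.1 hp))
  obtain ⟨θ, hθ⟩ : ∃ θ : OneForm M, ∀ p : TangentBundle (𝓡 3) M,
      θ p.1 p.2 = ∑ᶠ x₀, ρ x₀ p.1 * g x₀ p := by
    have hfin : ∀ x, (Function.support fun x₀ => ρ x₀ x).Finite := fun x =>
      ρ.locallyFinite.point_finite x
    let θ : M → E3 →L[ℝ] ℝ := fun x => ∑ x₀ ∈ (hfin x).toFinset,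
      ρ x₀ x • (inner ℝ (cX x₀ x) (cX x₀ x))⁻¹ • (innerSL ℝ (cX x₀ x)).comp (chartDeriv x₀ x)
    have hθ : ∀ x v, θ x v = ∑ x₀ ∈ (hfin x).toFinset,
        ρ x₀ x * ((inner ℝ (cX x₀ x) (cX x₀ x))⁻¹ * inner ℝ (cX x₀ x) (chartDeriv x₀ x v)) := by
      intro x v
      simp [θ]
    refine ⟨θ, fun p => (hθ p.1 p.2).trans ?_⟩
    rw [finsum_eq_sum_of_support_subset (s := (hfin p.1).toFinset)]
    · refine Finset.sum_congr rfl fun x₀ _ => ?_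
      rw [hg, inv_mul_eq_div]
      rfl
    · intro x₀ hx₀
      simp only [Finite.coe_toFinset]
      exact left_ne_zero_of_mul hx₀
  refine ⟨θ, ?_, fun x => ?_⟩
  · simp_rw [hθ]
    refine continuous_finsum (fun x₀ => continuous_iff_continuousAt.2 fun p => ?_) ?_
    · by_cases hp : p.1 ∈ tsupport (ρ x₀)
      · exact ((ρ x₀).continuous.comp hproj).continuousAt.mul ((hgc x₀).continuousAt
          (hproj.continuousAt.preimage_mem_nhds
            ((isOpen_extChartAt_source x₀).mem_nhds (hρ x₀ hp))))
      · refine (continuousAt_const (y := (0 : ℝ))).congr ?_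
        filter_upwards [hproj.continuousAt.preimage_mem_nhds
          ((isClosed_tsupport (ρ x₀)).isOpen_compl.mem_nhds hp)] with q hq
        rw [image_eq_zero_of_notMem_tsupport hq, zero_mul]
    · refine (ρ.locallyFinite.preimage_continuous hproj).subset fun x₀ p hp => ?_
      exact left_ne_zero_of_mul hp
  · have h1 := hθ ⟨x, X x⟩
    rw [show θ x (X x) = _ from h1, ← ρ.sum_eq_one (mem_univ x)]
    refine finsum_congr fun x₀ => ?_
    by_cases hx : x ∈ (extChartAt (𝓡 3) x₀).source
    · have : g x₀ ⟨x, X x⟩ = 1 := div_self (inner_self_ne_zero.2 (hcX0 x₀ x hx))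
      rw [this, mul_one]
    · have : ρ x₀ x = 0 := image_eq_zero_of_notMem_tsupport fun h => hx (hρ x₀ h)
      rw [this, zero_mul]

end PAFlow
end

/-! ### Lifting contracted lines from the normal bundle to the tangent bundle. -/

noncomputable section
namespace PAFlow
open Set Filter Metric Bundle

universe u
variable {M : Type u} [TopologicalSpace M] [ChartedSpace E3 M] [IsManifold (𝓡 3) ∞ M]

/-- Continuity is smoothness of order 0, so the rules for smooth sections of a vector bundle apply.
-/
theorem continuousOn_section_sub_smul {U : Set M} {e f : VField M} {a : M → ℝ}
    (he : ContinuousOn (fun x => (⟨x, e x⟩ : TangentBundle (𝓡 3) M)) U)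
    (hf : ContinuousOn (fun x => (⟨x, f x⟩ : TangentBundle (𝓡 3) M)) U) (ha : ContinuousOn a U) :
    ContinuousOn (fun x => (⟨x, e x - a x • f x⟩ : TangentBundle (𝓡 3) M)) U := by
  have h0 : IsManifold (𝓡 3) (0 + 1) M := by
    rw [zero_add]; infer_instance
  have h1 : ContMDiffOn (𝓡 3) (𝓡 3).tangent 0
      (fun x => (⟨x, e x⟩ : TangentBundle (𝓡 3) M)) U := contMDiffOn_zero_iff.2 he
  have h2 : ContMDiffOn (𝓡 3) (𝓡 3).tangent 0
      (fun x => (⟨x, f x⟩ : TangentBundle (𝓡 3) M)) U := contMDiffOn_zero_iff.2 hf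
  have h3 : ContMDiffOn (𝓡 3) 𝓘(ℝ, ℝ) 0 a U := contMDiffOn_zero_iff.2 ha
  exact contMDiffOn_zero_iff.1 (h1.sub_section (h3.smul_section h2))

variable [CompactSpace M] {X : VField M} {φ : Flow ℝ M}

/-- The variation of a `1`-form along the flow is bounded by the norm of the normal component, on
vectors whose normal component lies in a continuous line field. -/
theorem exists_bound_sub_tflow (hX : IsC1Field X) (h : Generates X φ)
    {θ : OneForm M} (hθ : Continuous (fun p : TangentBundle (𝓡 3) M => θ p.1 p.2))
    (hθX : ∀ x, θ x (X x) = 1)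
    {L : ∀ x : M, Submodule ℝ (NormalSpace X x)} (hL : IsContNormalLineField X L)
    {N : ∀ x : M, Seminorm ℝ (NormalSpace X x)} (hN : IsContNormalNorm X N) (t : ℝ) :
    ∃ K, 0 ≤ K ∧ ∀ p : TangentBundle (𝓡 3) M, normalProj X p.1 p.2 ∈ L p.1 →
      |θ (tflow φ t p).1 (tflow φ t p).2 - θ p.1 p.2| ≤ K * N p.1 (normalProj X p.1 p.2) := by
  suffices hloc : ∀ x₀, ∃ K, ∀ᶠ x in 𝓝 x₀, ∀ v : TangentSpace (𝓡 3) x, normalProj X x v ∈ L x →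
      |θ (φ t x) (dflow φ t x v) - θ x v| ≤ K * N x (normalProj X x v) by
    obtain ⟨K, hK, hP⟩ := exists_forall_of_locally (fun K K' x hKK' hP v hv =>
      (hP v hv).trans (by gcongr)) hloc
    exact ⟨K, hK, fun p hp => hP p.1 p.2 hp⟩
  intro x₀
  obtain ⟨U, hU, e, he, heL⟩ := hL x₀
  set D : M → ℝ := fun x => |θ (φ t x) (dflow φ t x (e x)) - θ x (e x)| with hD
  set R : M → ℝ := fun x => N x (normalProj X x (e x)) with hR
  have heAt : ContinuousAt (fun x => (⟨x, e x⟩ : TangentBundle (𝓡 3) M)) x₀ := he.continuousAt hU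
  have hDc : ContinuousAt D x₀ :=
    (ContinuousAt.sub
      (ContinuousAt.comp (g := fun p => θ (tflow φ t p).1 (tflow φ t p).2)
        (hθ.comp (continuous_tflow hX h t)).continuousAt heAt)
      (ContinuousAt.comp (g := fun p : TangentBundle (𝓡 3) M => θ p.1 p.2)
        hθ.continuousAt heAt)).abs
  have hRc : ContinuousAt R x₀ :=
    ContinuousAt.comp (g := fun p : TangentBundle (𝓡 3) M => N p.1 (normalProj X p.1 p.2))
      hN.2.continuousAt heAt
  have hR0 : ∀ x ∈ U, R x ≠ 0 := fun x hx h0 => (heL x hx).1 (hN.1 x _ h0)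
  have hRx₀ := hR0 x₀ (mem_of_mem_nhds hU)
  -- Both sides are absolutely homogeneous and ignore multiples of `X`, so the best constant at `x`
  -- is the ratio `D x / R x` on the spanning section. This ratio is continuous at `x₀`.
  refine ⟨D x₀ / R x₀ + 1, ?_⟩
  filter_upwards [hU, (hDc.div hRc hRx₀).eventually_lt_const (lt_add_one _)] with x hxU hx v hv
  rw [(heL x hxU).2] at hv
  obtain ⟨a, c, rfl⟩ := exists_eq_smul_add_smul hv
  have hRpos : 0 < R x := lt_of_le_of_ne (apply_nonneg _ _) (hR0 x hxU).symm
  have h1 : normalProj X x (a • e x + c • X x) = a • normalProj X x (e x) := by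
    rw [map_add, map_smul, normalProj_eq_zero_iff.2 ⟨c, rfl⟩, add_zero]
  -- The `X` component contributes `c` to both terms, since the flow preserves `X` and `θ X = 1`
  -- everywhere.
  have h2 : θ (φ t x) (dflow φ t x (a • e x + c • X x)) - θ x (a • e x + c • X x) =
      a * (θ (φ t x) (dflow φ t x (e x)) - θ x (e x)) := by
    simp only [map_add, map_smul, dflow_generator hX h, hθX, smul_eq_mul]
    ring
  rw [h1, h2, map_smul_eq_mul, abs_mul, Real.norm_eq_abs]
  have h3 : D x ≤ (D x₀ / R x₀ + 1) * R x := by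
    have : D x / R x < D x₀ / R x₀ + 1 := hx
    exact ((div_lt_iff₀ hRpos).1 this).le
  calc |a| * D x ≤ |a| * ((D x₀ / R x₀ + 1) * R x) := by gcongr
    _ = _ := by ring

/-- A continuous invariant line field in the normal bundle contracted by the flow, forwards or
backwards in time, lifts to a continuous invariant line field in the tangent bundle. -/
theorem exists_invariant_lift (hX : IsC1Field X) (h : Generates X φ)
    {θ : OneForm M} (hθ : Continuous (fun p : TangentBundle (𝓡 3) M => θ p.1 p.2))
    (hθX : ∀ x, θ x (X x) = 1)
    {L : ∀ x : M, Submodule ℝ (NormalSpace X x)} (hL : IsContNormalLineField X L)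
    (hinv : ∀ t x, (L x).map (poincareFlow h t x) = L (φ t x))
    {N : ∀ x : M, Seminorm ℝ (NormalSpace X x)} (hN : IsContNormalNorm X N)
    {τ r : ℝ} (hr0 : 0 ≤ r) (hr : r < 1)
    (hc : ∀ x, ∀ w ∈ L x, N (φ τ x) (poincareFlow h τ x w) ≤ r * N x w) :
    ∃ E : ∀ x : M, Submodule ℝ (TangentSpace (𝓡 3) x), IsContLineField E ∧
      (∀ t x, (E x).map (dflow φ t x).toLinearMap = E (φ t x)) ∧
      (∀ x, ∀ w ∈ E x, normalProj X x w ∈ L x) ∧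
      ∀ x, ∀ w ∈ E x, normalProj X x w = 0 → w = 0 := by
  -- The set `W` is the plane field over `L`, and `A` is the limit of the pullbacks of `θ` along it.
  obtain ⟨A, hAc, hAlim, hAinv⟩ := exists_invariant_limit (T := TangentBundle (𝓡 3) M)
    (Φ := tflow φ) (W := {p | normalProj X p.1 p.2 ∈ L p.1})
    (N := fun p => N p.1 (normalProj X p.1 p.2)) (θ := fun p => θ p.1 p.2) (τ := τ) (r := r)
    (tflow_add hX h) tflow_zero (continuous_tflow hX h)
    (fun t p hp => by
      have := Submodule.mem_map_of_mem (f := poincareFlow h t p.1) hp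
      rw [hinv] at this
      exact this) hN.2 hθ (fun t => exists_bound_sub_tflow hX h hθ hθX hL hN t) hr0 hr
    (fun p hp => hc p.1 _ hp)
  have hAX : ∀ x (c : ℝ), A ⟨x, c • X x⟩ = c := by
    intro x c
    refine tendsto_nhds_unique (hAlim ⟨x, c • X x⟩ ?_) ?_
    · change normalProj X x (c • X x) ∈ L x
      rw [normalProj_eq_zero_iff.2 ⟨c, rfl⟩]
      exact zero_mem _
    · refine tendsto_const_nhds.congr fun n => ?_
      change c = θ (φ (n * τ) x) (dflow φ (n * τ) x (c • X x))
      rw [map_smul, dflow_generator hX h, map_smul, hθX, smul_eq_mul, mul_one]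
  have hAadd : ∀ x v w, normalProj X x v ∈ L x → normalProj X x w ∈ L x →
      A ⟨x, v + w⟩ = A ⟨x, v⟩ + A ⟨x, w⟩ := by
    intro x v w hv hw
    refine tendsto_nhds_unique (hAlim ⟨x, v + w⟩ ?_) (((hAlim ⟨x, v⟩ hv).add
      (hAlim ⟨x, w⟩ hw)).congr fun n => ?_)
    · change normalProj X x (v + w) ∈ L x
      rw [map_add]
      exact add_mem hv hw
    · change θ (φ (n * τ) x) (dflow φ (n * τ) x v) + θ (φ (n * τ) x) (dflow φ (n * τ) x w) =
        θ (φ (n * τ) x) (dflow φ (n * τ) x (v + w))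
      rw [map_add, map_add]
  have hAsmul : ∀ x (a : ℝ) v, normalProj X x v ∈ L x → A ⟨x, a • v⟩ = a * A ⟨x, v⟩ := by
    intro x a v hv
    refine tendsto_nhds_unique (hAlim ⟨x, a • v⟩ ?_) (((hAlim ⟨x, v⟩ hv).const_mul a).congr
      fun n => ?_)
    · change normalProj X x (a • v) ∈ L x
      rw [map_smul]
      exact (L x).smul_mem a hv
    · change a * θ (φ (n * τ) x) (dflow φ (n * τ) x v) =
        θ (φ (n * τ) x) (dflow φ (n * τ) x (a • v))
      rw [map_smul, map_smul, smul_eq_mul]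
  -- The lift is the kernel of `A` in the plane field over `L`. It is transverse to `X` because `A X
  -- = 1`.
  let E : ∀ x : M, Submodule ℝ (TangentSpace (𝓡 3) x) := fun x =>
    { carrier := {w | normalProj X x w ∈ L x ∧ A ⟨x, w⟩ = 0}
      add_mem' := fun {v w} hv hw => ⟨by
        rw [map_add]; exact add_mem hv.1 hw.1, by
        rw [hAadd x v w hv.1 hw.1, hv.2, hw.2, add_zero]⟩
      zero_mem' := ⟨by rw [map_zero]; exact zero_mem _, by simpa using hAX x 0⟩
      smul_mem' := fun a v hv => ⟨by
        rw [map_smul]; exact (L x).smul_mem a hv.1, by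
        rw [hAsmul x a v hv.1, hv.2, mul_zero]⟩ }
  refine ⟨E, fun x₀ => ?_, map_dflow_eq_of_forall_mem hX h fun t x v hv => ⟨?_, ?_⟩,
    fun x w hw => hw.1, fun x w hw hw0 => ?_⟩
  · obtain ⟨U, hU, e, he, heL⟩ := hL x₀
    have heL' : ∀ x ∈ U, normalProj X x (e x) ∈ L x := fun x hx => by
      rw [(heL x hx).2]
      exact Submodule.mem_span_singleton_self _
    have hAe : ContinuousOn (fun x => A ⟨x, e x⟩) U := hAc.comp he (fun x hx => heL' x hx)
    -- Subtracting `A e • X` projects the given section over `L` onto the kernel of `A` along `X`.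
    refine ⟨U, hU, fun x => e x - A ⟨x, e x⟩ • X x,
      continuousOn_section_sub_smul he hX.continuous.continuousOn hAe, fun x hx => ⟨?_, ?_⟩⟩
    · intro h0
      refine (heL x hx).1 (normalProj_eq_zero_iff.2 ⟨A ⟨x, e x⟩, sub_eq_zero.1 h0⟩)
    · have hmem : e x - A ⟨x, e x⟩ • X x ∈ E x := by
        have h1 : normalProj X x ((-A ⟨x, e x⟩) • X x) ∈ L x := by
          rw [normalProj_eq_zero_iff.2 ⟨_, rfl⟩]
          exact zero_mem _
        rw [sub_eq_add_neg, ← neg_smul]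
        refine ⟨?_, ?_⟩
        · rw [map_add]
          exact add_mem (heL' x hx) h1
        · rw [hAadd x _ _ (heL' x hx) h1, hAX, add_neg_cancel]
      refine le_antisymm (fun w hw => ?_) ((Submodule.span_singleton_le_iff_mem _ _).2 hmem)
      have hwL : normalProj X x w ∈ L x := hw.1
      rw [(heL x hx).2] at hwL
      obtain ⟨a, c, rfl⟩ := exists_eq_smul_add_smul hwL
      have h1 : normalProj X x (a • e x) ∈ L x := by
        rw [map_smul]
        exact (L x).smul_mem a (heL' x hx)
      have h2 : normalProj X x (c • X x) ∈ L x := by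
        rw [normalProj_eq_zero_iff.2 ⟨_, rfl⟩]
        exact zero_mem _
      have h3 : a * A ⟨x, e x⟩ + c = 0 := by
        rw [← hAsmul x a _ (heL' x hx), ← hAX x c, ← hAadd x _ _ h1 h2]
        exact hw.2
      refine Submodule.mem_span_singleton.2 ⟨a, ?_⟩
      rw [eq_neg_of_add_eq_zero_right h3, smul_sub, neg_smul, smul_smul, sub_eq_add_neg]
  · have := Submodule.mem_map_of_mem (f := poincareFlow h t x) hv.1
    rw [hinv] at this
    exact this
  · exact (hAinv t ⟨x, v⟩ hv.1).trans hv.2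
  · obtain ⟨c, rfl⟩ := normalProj_eq_zero_iff.1 hw0
    have : c = 0 := (hAX x c).symm.trans hw.2
    rw [this, zero_smul]

end PAFlow
end

/-! ### The adapted norm on the normal bundle. -/

noncomputable section
namespace PAFlow
open Set Filter Metric Bundle

section Algebra

variable {V : Type*} [AddCommGroup V] [Module ℝ V]

/-- Multiples of `x` drop out because `f` is alternating. Hence `Ω (X, ·, ·)` depends only on normal
components. -/
theorem alternatingMap_apply_smul_add_smul (f : V [⋀^Fin 3]→ₗ[ℝ] ℝ) (x s u : V) (a b c d : ℝ) :
    f ![x, a • s + c • x, b • u + d • x] = a * b * f ![x, s, u] := by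
  have h1 : ∀ y w z : V, Function.update ![x, y, z] 1 w = ![x, w, z] := by
    intro y w z
    funext i
    fin_cases i <;> rfl
  have h2 : ∀ y w z : V, Function.update ![x, y, z] 2 w = ![x, y, w] := by
    intro y w z
    funext i
    fin_cases i <;> rfl
  have h3 : ∀ z : V, f ![x, x, z] = 0 := fun z =>
    f.map_eq_zero_of_eq _ (i := 0) (j := 1) rfl (by decide)
  have h4 : ∀ z : V, f ![x, z, x] = 0 := fun z =>
    f.map_eq_zero_of_eq _ (i := 0) (j := 2) rfl (by decide)
  have e1 : ∀ y y' z : V, f ![x, y + y', z] = f ![x, y, z] + f ![x, y', z] := fun y y' z => by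
    simpa only [h1] using f.map_update_add ![x, y, z] 1 y y'
  have e2 : ∀ (r : ℝ) (y z : V), f ![x, r • y, z] = r * f ![x, y, z] := fun r y z => by
    simpa only [h1, smul_eq_mul] using f.map_update_smul ![x, y, z] 1 r y
  have e3 : ∀ y z z' : V, f ![x, y, z + z'] = f ![x, y, z] + f ![x, y, z'] := fun y z z' => by
    simpa only [h2] using f.map_update_add ![x, y, z] 2 z z'
  have e4 : ∀ (r : ℝ) (y z : V), f ![x, y, r • z] = r * f ![x, y, z] := fun r y z => by
    simpa only [h2, smul_eq_mul] using f.map_update_smul ![x, y, z] 2 r z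
  rw [e1, e2, e2, h3, e3, e4, e4, h4]
  ring

theorem alternatingMap_ne_zero_of_linearIndependent [FiniteDimensional ℝ V]
    (hV : Module.finrank ℝ V = 3) {f : V [⋀^Fin 3]→ₗ[ℝ] ℝ} (hf : f ≠ 0) {e : Fin 3 → V}
    (he : LinearIndependent ℝ e) : f e ≠ 0 := by
  have h := (f.map_basis_ne_zero_iff
    (basisOfLinearIndependentOfCardEqFinrank he (by simp [hV]))).2 hf
  rwa [coe_basisOfLinearIndependentOfCardEqFinrank] at h

end Algebra

/-- Two pairs of positive numbers with the same product whose ratios grow. -/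
theorem le_of_mul_eq_of_ratio {a b a' b' E : ℝ} (ha : 0 < a) (hb : 0 < b) (ha' : 0 < a')
    (hE : 0 < E) (hprod : a' * b' = a * b) (hratio : E ^ 2 * (b / a) ≤ b' / a') :
    E * a' ≤ a ∧ E * b ≤ b' := by
  have h1 : E ^ 2 * b * a' ≤ b' * a := by
    rw [← mul_div_assoc, div_le_div_iff₀ ha ha'] at hratio
    exact hratio
  -- Multiplying the ratio inequality by `a'` and using that the products agree leaves `b * (E * a')
  -- ^ 2 ≤ b * a ^ 2`. The growth `E ^ 2` of the ratio is shared equally by its two terms.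
  have h2 : (E * a') ^ 2 ≤ a ^ 2 := by
    have : b * (E * a') ^ 2 ≤ b * a ^ 2 := by
      calc b * (E * a') ^ 2 = (E ^ 2 * b * a') * a' := by ring
        _ ≤ (b' * a) * a' := by gcongr
        _ = (a' * b') * a := by ring
        _ = b * a ^ 2 := by rw [hprod]; ring
    exact le_of_mul_le_mul_left this hb
  have h3 : E * a' ≤ a := (sq_le_sq₀ (by positivity) ha.le).1 h2
  refine ⟨h3, le_of_mul_le_mul_left (?_ : a' * (E * b) ≤ a' * b') ha'⟩
  calc a' * (E * b) = (E * a') * b := by ring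
    _ ≤ a * b := by gcongr
    _ = a' * b' := hprod.symm

universe u
variable {M : Type u} [TopologicalSpace M] [ChartedSpace E3 M] {X : VField M}

theorem finrank_tangentSpace (x : M) : Module.finrank ℝ (TangentSpace (𝓡 3) x) = 3 := by
  change Module.finrank ℝ E3 = 3
  simp

/-- In the normal bundle a linear relation loses its `X` term, and the other two terms lie in
disjoint subspaces, so both vanish. Then the coefficient of `X` vanishes too. -/
theorem linearIndependent_generator {x : M} (hX0 : X x ≠ 0)
    {L₁ L₂ : Submodule ℝ (NormalSpace X x)} (hL : Disjoint L₁ L₂) {e₁ e₂ : TangentSpace (𝓡 3) x}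
    (h₁ : normalProj X x e₁ ∈ L₁) (h₂ : normalProj X x e₂ ∈ L₂) (h₁' : normalProj X x e₁ ≠ 0)
    (h₂' : normalProj X x e₂ ≠ 0) : LinearIndependent ℝ ![X x, e₁, e₂] := by
  refine Fintype.linearIndependent_iff.2 fun g hg => ?_
  rw [Fin.sum_univ_three] at hg
  replace hg : g 0 • X x + g 1 • e₁ + g 2 • e₂ = 0 := hg
  have h3 : g 1 • normalProj X x e₁ + g 2 • normalProj X x e₂ = 0 := by
    have := congrArg (normalProj X x) hg
    rwa [map_add, map_add, map_smul, map_smul, map_smul,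
      normalProj_eq_zero_iff.2 ⟨1, (one_smul ℝ (X x)).symm⟩, smul_zero, zero_add, map_zero] at this
  have h4 : g 1 • normalProj X x e₁ = 0 := by
    refine Submodule.disjoint_def.1 hL _ (L₁.smul_mem _ h₁) ?_
    rw [eq_neg_of_add_eq_zero_left h3]
    exact neg_mem (L₂.smul_mem _ h₂)
  have g1 : g 1 = 0 := (smul_eq_zero.1 h4).resolve_right h₁'
  rw [h4, zero_add] at h3
  have g2 : g 2 = 0 := (smul_eq_zero.1 h3).resolve_right h₂'
  rw [g1, g2, zero_smul, zero_smul, add_zero, add_zero] at hg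
  have g0 : g 0 = 0 := (smul_eq_zero.1 hg).resolve_right hX0
  intro i
  fin_cases i <;> assumption

variable [IsManifold (𝓡 3) ∞ M]

/-- The density comparing a volume form with the product of the norms of a pair of transverse
vectors is a continuous function. -/
theorem exists_continuous_density (hX : IsC1Field X) (hX0 : ∀ x, X x ≠ 0)
    {Es Eu : ∀ x : M, Submodule ℝ (NormalSpace X x)} (hEs : IsContNormalLineField X Es)
    (hEu : IsContNormalLineField X Eu) (hcompl : ∀ x, IsCompl (Es x) (Eu x))
    {N : ∀ x : M, Seminorm ℝ (NormalSpace X x)} (hN : IsContNormalNorm X N)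
    {Ω : ThreeForm M} (hΩ : IsC0VolumeForm Ω) :
    ∃ A : M → ℝ, Continuous A ∧ (∀ x, 0 < A x) ∧
      ∀ x s u, normalProj X x s ∈ Es x → normalProj X x u ∈ Eu x →
        A x * (N x (normalProj X x s) * N x (normalProj X x u)) = |Ω x ![X x, s, u]| := by
  -- Locally the density is the quotient of the two sides on spanning sections. A pair with nonzero
  -- product of norms is recorded because it determines the density, so that local densities agree
  -- on overlaps.
  have hloc : ∀ x₀ : M, ∃ U ∈ 𝓝 x₀, ∃ B : M → ℝ, ContinuousOn B U ∧ ∀ x ∈ U, 0 < B x ∧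
      (∃ s u, normalProj X x s ∈ Es x ∧ normalProj X x u ∈ Eu x ∧
        N x (normalProj X x s) * N x (normalProj X x u) ≠ 0) ∧
      ∀ s u, normalProj X x s ∈ Es x → normalProj X x u ∈ Eu x →
        B x * (N x (normalProj X x s) * N x (normalProj X x u)) = |Ω x ![X x, s, u]| := by
    intro x₀
    obtain ⟨U₁, hU₁, e₁, he₁, hL₁⟩ := hEs x₀
    obtain ⟨U₂, hU₂, e₂, he₂, hL₂⟩ := hEu x₀
    set U := U₁ ∩ U₂ ∩ (extChartAt (𝓡 3) x₀).source with hU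
    have hUn : U ∈ 𝓝 x₀ := inter_mem (inter_mem hU₁ hU₂) (extChartAt_source_mem_nhds x₀)
    have hs₁ : U ⊆ U₁ := fun x hx => hx.1.1
    have hs₂ : U ⊆ U₂ := fun x hx => hx.1.2
    have hN0 : ∀ (e : VField M) x, normalProj X x (e x) ≠ 0 → N x (normalProj X x (e x)) ≠ 0 :=
      fun e x he h0 => he (hN.1 x _ h0)
    have hNc : ∀ e : VField M, ContinuousOn (fun x => (⟨x, e x⟩ : TangentBundle (𝓡 3) M)) U →
        ContinuousOn (fun x => N x (normalProj X x (e x))) U := fun e he =>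
      hN.2.comp_continuousOn he
    have hfr : ∀ x, (fun i => (![X, e₁, e₂] : Fin 3 → VField M) i x) = ![X x, e₁ x, e₂ x] := by
      intro x
      funext i
      fin_cases i <;> rfl
    have hΩc : ContinuousOn (fun x => Ω x ![X x, e₁ x, e₂ x]) U := by
      have h1 := continuousOn_threeForm_apply (e := ![X, e₁, e₂]) hΩ
        (U := U) (x₀ := x₀) (fun x hx => hx.2) (fun i => by
          fin_cases i
          · exact hX.continuous.continuousOn
          · exact he₁.mono hs₁
          · exact he₂.mono hs₂)
      exact h1.congr fun x _ => (congrArg (Ω x) (hfr x)).symm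
    have hmem₁ : ∀ x ∈ U, normalProj X x (e₁ x) ∈ Es x := fun x hx => by
      rw [(hL₁ x (hs₁ hx)).2]
      exact Submodule.mem_span_singleton_self _
    have hmem₂ : ∀ x ∈ U, normalProj X x (e₂ x) ∈ Eu x := fun x hx => by
      rw [(hL₂ x (hs₂ hx)).2]
      exact Submodule.mem_span_singleton_self _
    have hne : ∀ x ∈ U, N x (normalProj X x (e₁ x)) * N x (normalProj X x (e₂ x)) ≠ 0 :=
      fun x hx => mul_ne_zero (hN0 e₁ x (hL₁ x (hs₁ hx)).1) (hN0 e₂ x (hL₂ x (hs₂ hx)).1)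
    refine ⟨U, hUn, fun x => |Ω x ![X x, e₁ x, e₂ x]| /
      (N x (normalProj X x (e₁ x)) * N x (normalProj X x (e₂ x))),
      hΩc.abs.div ((hNc e₁ (he₁.mono hs₁)).mul (hNc e₂ (he₂.mono hs₂))) hne, fun x hx =>
      ⟨?_, ⟨e₁ x, e₂ x, hmem₁ x hx, hmem₂ x hx, hne x hx⟩, fun s u hs hu => ?_⟩⟩
    · have h1 : Ω x ![X x, e₁ x, e₂ x] ≠ 0 := by
        have : FiniteDimensional ℝ (TangentSpace (𝓡 3) x) :=
          inferInstanceAs (FiniteDimensional ℝ E3)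
        refine alternatingMap_ne_zero_of_linearIndependent (f := (Ω x).toAlternatingMap)
          (finrank_tangentSpace x) (fun h0 => hΩ.2 x ?_) (linearIndependent_generator (hX0 x)
            (hcompl x).disjoint (hmem₁ x hx) (hmem₂ x hx) (hL₁ x (hs₁ hx)).1 (hL₂ x (hs₂ hx)).1)
        exact ContinuousAlternatingMap.toAlternatingMap_injective h0
      have h2 := hne x hx
      have h3 : 0 ≤ N x (normalProj X x (e₁ x)) * N x (normalProj X x (e₂ x)) :=
        mul_nonneg (apply_nonneg _ _) (apply_nonneg _ _)
      exact div_pos (abs_pos.2 h1) (lt_of_le_of_ne h3 h2.symm)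
    · rw [(hL₁ x (hs₁ hx)).2] at hs
      rw [(hL₂ x (hs₂ hx)).2] at hu
      obtain ⟨a, c, rfl⟩ := exists_eq_smul_add_smul hs
      obtain ⟨b, d, rfl⟩ := exists_eq_smul_add_smul hu
      have h1 : Ω x ![X x, a • e₁ x + c • X x, b • e₂ x + d • X x] =
          a * b * Ω x ![X x, e₁ x, e₂ x] :=
        alternatingMap_apply_smul_add_smul (Ω x).toAlternatingMap _ _ _ a b c d
      have h2 : ∀ (r q : ℝ) (v : TangentSpace (𝓡 3) x),
          N x (normalProj X x (r • v + q • X x)) = |r| * N x (normalProj X x v) := by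
        intro r q v
        rw [map_add, map_smul, normalProj_eq_zero_iff.2 ⟨q, rfl⟩, add_zero, map_smul_eq_mul,
          Real.norm_eq_abs]
      rw [h1, h2, h2, abs_mul, abs_mul, div_mul_eq_mul_div, div_eq_iff (hne x hx)]
      ring
  choose U hU B hBc hB using hloc
  refine ⟨fun x => B x x, continuous_iff_continuousAt.2 fun x₀ => ?_,
    fun x => (hB x x (mem_of_mem_nhds (hU x))).1, fun x => (hB x x (mem_of_mem_nhds (hU x))).2.2⟩
  refine ((hBc x₀).continuousAt (hU x₀)).congr ?_
  filter_upwards [hU x₀] with x hx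
  obtain ⟨s, u, hs, hu, hne⟩ := (hB x₀ x hx).2.1
  exact mul_right_cancel₀ hne (((hB x₀ x hx).2.2 s u hs hu).trans
    ((hB x x (mem_of_mem_nhds (hU x))).2.2 s u hs hu).symm)

variable [CompactSpace M] {φ : Flow ℝ M}

/-- A projectively Anosov flow preserving a volume form contracts one line field of the normal
bundle and expands the other one, for a suitable norm. -/
theorem exists_adapted_norm (hX : IsC1Field X) (hX0 : ∀ x, X x ≠ 0) (h : Generates X φ)
    {Es Eu : ∀ x : M, Submodule ℝ (NormalSpace X x)} (hEs : IsContNormalLineField X Es)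
    (hEu : IsContNormalLineField X Eu) (hcompl : ∀ x, IsCompl (Es x) (Eu x))
    (hsinv : ∀ t x, (Es x).map (poincareFlow h t x) = Es (φ t x))
    (huinv : ∀ t x, (Eu x).map (poincareFlow h t x) = Eu (φ t x))
    {N : ∀ x : M, Seminorm ℝ (NormalSpace X x)} (hN : IsContNormalNorm X N) {C : ℝ}
    (hC : ∀ t : ℝ, 0 ≤ t → ∀ x : M, ∀ w ∈ Es x, w ≠ 0 → ∀ v ∈ Eu x,
        Real.exp (C * t) * (N x v / N x w) ≤
          N (φ t x) (poincareFlow h t x v) / N (φ t x) (poincareFlow h t x w))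
    {Ω : ThreeForm M} (hΩ : IsC0VolumeForm Ω) (hΩφ : PreservesForm φ Ω) :
    ∃ N' : ∀ x : M, Seminorm ℝ (NormalSpace X x), IsContNormalNorm X N' ∧
      ∀ t : ℝ, 0 ≤ t → ∀ x : M,
        (∀ w ∈ Es x, N' (φ t x) (poincareFlow h t x w) ≤ Real.exp (-(C / 2) * t) * N' x w) ∧
        (∀ v ∈ Eu x, Real.exp (C / 2 * t) * N' x v ≤ N' (φ t x) (poincareFlow h t x v)) := by
  obtain ⟨A, hAc, hA0, hA⟩ := exists_continuous_density hX hX0 hEs hEu hcompl hN hΩ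
  -- The factor `√A` multiplies a product of two norms by `A`, which turns it into `|Ω (X, s, u)|`.
  let N' : ∀ x : M, Seminorm ℝ (NormalSpace X x) := fun x =>
    (√(A x)).toNNReal • N x
  have hN' : ∀ x v, N' x v = √(A x) * N x v := fun x v => by
    have h1 : N' x v = ((√(A x)).toNNReal : ℝ) * N x v := rfl
    rw [h1, Real.coe_toNNReal _ (Real.sqrt_nonneg _)]
  have hsq : ∀ x, 0 < √(A x) := fun x => Real.sqrt_pos.2 (hA0 x)
  refine ⟨N', ⟨fun x v hv => hN.1 x v ?_, ?_⟩, fun t ht x => ?_⟩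
  · exact (mul_eq_zero.1 ((hN' x v).symm.trans hv)).resolve_left (hsq x).ne'
  · simp_rw [hN']
    exact (hAc.sqrt.comp
      (FiberBundle.continuous_proj E3 (TangentSpace (𝓡 3) (M := M)))).mul hN.2
  have hprod : ∀ w ∈ Es x, ∀ v ∈ Eu x,
      N' (φ t x) (poincareFlow h t x w) * N' (φ t x) (poincareFlow h t x v) =
        N' x w * N' x v := by
    intro w hw v hv
    have hrule : ∀ y a b, N' y a * N' y b = A y * (N y a * N y b) := by
      intro y a b
      rw [hN', hN']
      calc _ = (√(A y) * √(A y)) * (N y a * N y b) := by ring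
        _ = _ := by rw [Real.mul_self_sqrt (hA0 y).le]
    have hw' := Submodule.mem_map_of_mem (f := poincareFlow h t x) hw
    have hv' := Submodule.mem_map_of_mem (f := poincareFlow h t x) hv
    rw [hsinv] at hw'
    rw [huinv] at hv'
    obtain ⟨s, rfl⟩ := Submodule.mkQ_surjective _ w
    obtain ⟨u, rfl⟩ := Submodule.mkQ_surjective _ v
    rw [hrule, hrule]
    refine (hA (φ t x) (dflow φ t x s) (dflow φ t x u) hw' hv').trans
      (Eq.trans (congrArg abs ?_) (hA x s u hw hv).symm)
    rw [← hΩφ t x, ContinuousAlternatingMap.compContinuousLinearMap_apply]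
    congr 1
    funext i
    fin_cases i
    · exact (dflow_generator hX h t x).symm
    · rfl
    · rfl
  have hpos : ∀ y v, v ≠ 0 → 0 < N' y v := fun y v hv => by
    rw [hN']
    exact mul_pos (hsq y) (lt_of_le_of_ne (apply_nonneg _ _) fun h0 => hv (hN.1 y v h0.symm))
  have hmain : ∀ w ∈ Es x, w ≠ 0 → ∀ v ∈ Eu x, v ≠ 0 →
      Real.exp (C / 2 * t) * N' (φ t x) (poincareFlow h t x w) ≤ N' x w ∧
      Real.exp (C / 2 * t) * N' x v ≤ N' (φ t x) (poincareFlow h t x v) := by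
    intro w hw hw0 v hv hv0
    have h1 := hprod w hw v hv
    -- The image of `w` is nonzero because the invariant product would otherwise vanish.
    have h2 : 0 < N' (φ t x) (poincareFlow h t x w) := by
      refine lt_of_le_of_ne (apply_nonneg _ _) fun h0 => ?_
      rw [← h0, zero_mul] at h1
      exact (mul_pos (hpos x w hw0) (hpos x v hv0)).ne h1
    refine le_of_mul_eq_of_ratio (hpos x w hw0) (hpos x v hv0) h2 (Real.exp_pos _) h1 ?_
    have h3 := hC t ht x w hw hw0 v hv
    -- Both vectors of each ratio lie over the same point, so `√A` cancels and domination holds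
    -- unchanged for `N'`, with `e^{Ct}` written as the square of `e^{Ct/2}`.
    rw [hN', hN', hN', hN', mul_div_mul_left _ _ (hsq _).ne', mul_div_mul_left _ _ (hsq _).ne',
      ← Real.exp_nat_mul]
    convert h3 using 3
    push_cast
    ring
  -- The comparison needs a nonzero partner in the other line; spanning sections supply one in each.
  obtain ⟨_, hUs, e₁, -, hL₁⟩ := hEs x
  obtain ⟨_, hUu, e₂, -, hL₂⟩ := hEu x
  have hs := hL₁ x (mem_of_mem_nhds hUs)
  have hu := hL₂ x (mem_of_mem_nhds hUu)
  have hs' : normalProj X x (e₁ x) ∈ Es x := by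
    rw [hs.2]
    exact Submodule.mem_span_singleton_self _
  have hu' : normalProj X x (e₂ x) ∈ Eu x := by
    rw [hu.2]
    exact Submodule.mem_span_singleton_self _
  refine ⟨fun w hw => ?_, fun v hv => ?_⟩
  · rcases eq_or_ne w 0 with rfl | hw0
    · simp
    · have h1 := (hmain w hw hw0 _ hu' hu.1).1
      rw [neg_mul, Real.exp_neg, inv_mul_eq_div, le_div_iff₀ (Real.exp_pos _), mul_comm]
      exact h1
  · rcases eq_or_ne v 0 with rfl | hv0
    · simp
    · exact (hmain _ hs' hs.1 v hv hv0).2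

end PAFlow
end

/-! ### From hyperbolicity of the normal bundle to an Anosov splitting. -/

noncomputable section
namespace PAFlow
open Set Filter Metric Bundle

universe u
variable {M : Type u} [TopologicalSpace M] [ChartedSpace E3 M] [IsManifold (𝓡 3) ∞ M]
  [CompactSpace M] {X : VField M} {φ : Flow ℝ M}

/-- Expansion forwards in time is contraction backwards in time. -/
theorem poincareFlow_neg_le_of_expanding (hX : IsC1Field X) (h : Generates X φ)
    {L : ∀ x : M, Submodule ℝ (NormalSpace X x)}
    (hinv : ∀ t x, (L x).map (poincareFlow h t x) = L (φ t x))
    {N : ∀ x : M, Seminorm ℝ (NormalSpace X x)} {R t : ℝ} (hR : 0 < R)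
    (hexp : ∀ x, ∀ v ∈ L x, R * N x v ≤ N (φ t x) (poincareFlow h t x v)) (x : M)
    {v : NormalSpace X x} (hv : v ∈ L x) :
    N (φ (-t) x) (poincareFlow h (-t) x v) ≤ R⁻¹ * N x v := by
  have hv' := Submodule.mem_map_of_mem (f := poincareFlow h (-t) x) hv
  rw [hinv] at hv'
  obtain ⟨w, rfl⟩ := Submodule.mkQ_surjective _ v
  have h1 := hexp _ _ hv'
  have h2 : tflow φ t (tflow φ (-t) ⟨x, w⟩) = ⟨x, w⟩ := by
    rw [← tflow_add hX h, add_neg_cancel, tflow_zero]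
  have h3 := congrArg (fun p : TangentBundle (𝓡 3) M => N p.1 (normalProj X p.1 p.2)) h2
  rw [inv_mul_eq_div, le_div_iff₀ hR, mul_comm]
  exact h1.trans h3.le

omit [CompactSpace M] in
/-- An invariant splitting of the tangent bundle lying over a hyperbolic splitting of the normal
bundle makes the flow Anosov. -/
theorem isAnosov_of_lifts (hX : IsC1Field X) (hX0 : ∀ x, X x ≠ 0) (h : Generates X φ)
    {Es Eu : ∀ x : M, Submodule ℝ (NormalSpace X x)} (hdisj : ∀ x, Disjoint (Es x) (Eu x))
    {Ess Euu : ∀ x : M, Submodule ℝ (TangentSpace (𝓡 3) x)}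
    (hss : IsContLineField Ess) (huu : IsContLineField Euu)
    (hssinv : ∀ t x, (Ess x).map (dflow φ t x).toLinearMap = Ess (φ t x))
    (huuinv : ∀ t x, (Euu x).map (dflow φ t x).toLinearMap = Euu (φ t x))
    (hssEs : ∀ x, ∀ w ∈ Ess x, normalProj X x w ∈ Es x)
    (huuEu : ∀ x, ∀ w ∈ Euu x, normalProj X x w ∈ Eu x)
    (hss0 : ∀ x, ∀ w ∈ Ess x, normalProj X x w = 0 → w = 0)
    (huu0 : ∀ x, ∀ w ∈ Euu x, normalProj X x w = 0 → w = 0)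
    {N : ∀ x : M, Seminorm ℝ (NormalSpace X x)} (hN : IsContNormalNorm X N) {C : ℝ} (hC : 0 < C)
    (hhyp : ∀ t : ℝ, 0 ≤ t → ∀ x : M,
        (∀ w ∈ Es x, N (φ t x) (poincareFlow h t x w) ≤ Real.exp (-C * t) * N x w) ∧
        (∀ v ∈ Eu x, Real.exp (C * t) * N x v ≤ N (φ t x) (poincareFlow h t x v))) :
    IsAnosov X φ := by
  have hli : ∀ x, ∀ s ∈ Ess x, s ≠ 0 → ∀ u ∈ Euu x, u ≠ 0 →
      LinearIndependent ℝ ![X x, s, u] := fun x s hs hs0 u hu hu0 =>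
    linearIndependent_generator (hX0 x) (hdisj x) (hssEs x s hs) (huuEu x u hu)
      (fun h0 => hs0 (hss0 x s hs h0)) (fun h0 => hu0 (huu0 x u hu h0))
  -- `α x` is the coordinate along `X x` in the basis formed by `X x` and generators of the two
  -- lines.
  have hfib : ∀ x, ∃ α : TangentSpace (𝓡 3) x →ₗ[ℝ] ℝ, α (X x) = 1 ∧ (∀ w ∈ Ess x, α w = 0) ∧
      (∀ w ∈ Euu x, α w = 0) ∧ Ess x ⊔ Euu x ⊔ Submodule.span ℝ {X x} = ⊤ := by
    intro x
    obtain ⟨_, hU, s, -, hs⟩ := hss x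
    obtain ⟨_, hU', u, -, hu⟩ := huu x
    obtain ⟨hs0, hs⟩ := hs x (mem_of_mem_nhds hU)
    obtain ⟨hu0, hu⟩ := hu x (mem_of_mem_nhds hU')
    have hsm : s x ∈ Ess x := by rw [hs]; exact Submodule.mem_span_singleton_self _
    have hum : u x ∈ Euu x := by rw [hu]; exact Submodule.mem_span_singleton_self _
    have : FiniteDimensional ℝ (TangentSpace (𝓡 3) x) := inferInstanceAs (FiniteDimensional ℝ E3)
    have hli' := hli x _ hsm hs0 _ hum hu0
    let b := basisOfLinearIndependentOfCardEqFinrank hli' (by simp [finrank_tangentSpace x])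
    have hb : ⇑b = ![X x, s x, u x] := coe_basisOfLinearIndependentOfCardEqFinrank _ _
    have h0 : b 0 = X x := by rw [hb]; rfl
    have h1 : b 1 = s x := by rw [hb]; rfl
    have h2 : b 2 = u x := by rw [hb]; rfl
    refine ⟨b.coord 0, by rw [← h0]; simp, fun w hw => ?_, fun w hw => ?_, ?_⟩
    · rw [hs] at hw
      obtain ⟨a, rfl⟩ := Submodule.mem_span_singleton.1 hw
      rw [← h1]
      simp
    · rw [hu] at hw
      obtain ⟨a, rfl⟩ := Submodule.mem_span_singleton.1 hw
      rw [← h2]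
      simp
    · rw [eq_top_iff, ← b.span_eq, Submodule.span_le, hb]
      rintro _ ⟨i, rfl⟩
      fin_cases i
      · exact Submodule.mem_sup_right (Submodule.mem_span_singleton_self _)
      · exact Submodule.mem_sup_left (Submodule.mem_sup_left hsm)
      · exact Submodule.mem_sup_left (Submodule.mem_sup_right hum)
  choose α hαX hαs hαu htop using hfib
  have hαc : Continuous (fun p : TangentBundle (𝓡 3) M => α p.1 p.2) := by
    refine continuous_of_local_frame α fun x₀ => ?_
    obtain ⟨U₁, hU₁, s, hsc, hs⟩ := hss x₀
    obtain ⟨U₂, hU₂, u, huc, hu⟩ := huu x₀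
    have hsm : ∀ x ∈ U₁, s x ∈ Ess x := fun x hx => by
      rw [(hs x hx).2]; exact Submodule.mem_span_singleton_self _
    have hum : ∀ x ∈ U₂, u x ∈ Euu x := fun x hx => by
      rw [(hu x hx).2]; exact Submodule.mem_span_singleton_self _
    refine ⟨U₁ ∩ U₂, inter_mem hU₁ hU₂, ![X, s, u], fun i => ?_, fun x hx => ?_, fun i => ?_⟩
    · fin_cases i
      · exact hX.continuous.continuousOn
      · exact hsc.mono inter_subset_left
      · exact huc.mono inter_subset_right
    · have hfr : (fun i => (![X, s, u] : Fin 3 → VField M) i x) = ![X x, s x, u x] := by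
        funext i
        fin_cases i <;> rfl
      rw [hfr]
      exact hli x _ (hsm x hx.1) (hs x hx.1).1 _ (hum x hx.2) (hu x hx.2).1
    · fin_cases i
      · exact continuousOn_const.congr fun x _ => hαX x
      · exact continuousOn_const.congr fun x hx => hαs x _ (hsm x hx.1)
      · exact continuousOn_const.congr fun x hx => hαu x _ (hum x hx.2)
  -- The term `|α|` makes the seminorm definite along `X` and vanishes on both invariant lines. The
  -- estimates of the normal bundle thus carry over with the same rate and no extra factor.
  refine ⟨Ess, Euu, hss, huu, fun x => ⟨?_, ?_, ?_⟩, hssinv, huuinv,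
    fun x => (N x).comp (normalProj X x) + (normSeminorm ℝ ℝ).comp (α x), ⟨fun x v hv => ?_, ?_⟩,
    C, hC, fun t ht x => ⟨fun w hw => ?_, fun v hv => ?_⟩⟩
  · refine Submodule.disjoint_def.2 fun w hs hu => hss0 x w hs ?_
    exact Submodule.disjoint_def.1 (hdisj x) _ (hssEs x w hs) (huuEu x w hu)
  · refine Submodule.disjoint_def.2 fun w hw hwX => ?_
    obtain ⟨c, rfl⟩ := Submodule.mem_span_singleton.1 hwX
    obtain ⟨y, hy, z, hz, hyz⟩ := Submodule.mem_sup.1 hw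
    have h1 := congrArg (α x) hyz
    rw [map_add, hαs x y hy, hαu x z hz, map_smul, hαX, smul_eq_mul, mul_one, add_zero] at h1
    rw [← h1, zero_smul]
  · exact codisjoint_iff.2 (htop x)
  · have h1 : N x (normalProj X x v) + |α x v| = 0 := hv
    obtain ⟨h2, h3⟩ := (add_eq_zero_iff_of_nonneg (apply_nonneg _ _) (abs_nonneg _)).1 h1
    obtain ⟨c, rfl⟩ := normalProj_eq_zero_iff.1 (hN.1 x _ h2)
    rw [abs_eq_zero, map_smul, hαX, smul_eq_mul, mul_one] at h3
    rw [h3, zero_smul]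
  · exact hN.2.add hαc.abs
  · have hw' := Submodule.mem_map_of_mem (f := (dflow φ t x).toLinearMap) hw
    rw [hssinv] at hw'
    change N (φ t x) (normalProj X (φ t x) (dflow φ t x w)) + |α (φ t x) (dflow φ t x w)| ≤
      Real.exp (-C * t) * (N x (normalProj X x w) + |α x w|)
    rw [hαs x w hw, show α (φ t x) (dflow φ t x w) = 0 from hαs _ _ hw', abs_zero, add_zero,
      add_zero]
    exact (hhyp t ht x).1 _ (hssEs x w hw)
  · have hv' := Submodule.mem_map_of_mem (f := (dflow φ t x).toLinearMap) hv
    rw [huuinv] at hv'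
    change Real.exp (C * t) * (N x (normalProj X x v) + |α x v|) ≤
      N (φ t x) (normalProj X (φ t x) (dflow φ t x v)) + |α (φ t x) (dflow φ t x v)|
    rw [hαu x v hv, show α (φ t x) (dflow φ t x v) = 0 from hαu _ _ hv', abs_zero, add_zero,
      add_zero]
    exact (hhyp t ht x).2 _ (huuEu x v hv)

/-- A projectively Anosov flow preserving a continuous volume form is Anosov. -/
theorem isAnosov_of_preservesForm [T2Space M] (hX : IsC1Field X) (hX0 : ∀ x, X x ≠ 0)
    (h : Generates X φ) (hPA : IsProjectivelyAnosov h) {Ω : ThreeForm M} (hΩ : IsC0VolumeForm Ω)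
    (hΩφ : PreservesForm φ Ω) : IsAnosov X φ := by
  obtain ⟨Es, Eu, hEs, hEu, hcompl, hsinv, huinv, N₀, hN₀, C, hC, hratio⟩ := hPA
  obtain ⟨N, hN, hhyp⟩ := exists_adapted_norm hX hX0 h hEs hEu hcompl hsinv huinv hN₀ hratio hΩ hΩφ
  obtain ⟨θ, hθ, hθX⟩ := exists_continuous_oneForm hX hX0
  have hr : Real.exp (-(C / 2)) < 1 := 
    (Real.exp_lt_exp.2 (by linarith : -(C / 2) < 0)).trans_eq Real.exp_zero
  obtain ⟨Ess, hss, hssinv, hssEs, hss0⟩ := exists_invariant_lift hX h hθ hθX hEs hsinv hN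
    (τ := 1) (Real.exp_pos _).le hr (fun x w hw => by
      simpa using (hhyp 1 zero_le_one x).1 w hw)
  -- The expanded line is contracted by the time `-1` map, so the same lifting applies with `τ =
  -- -1`.
  obtain ⟨Euu, huu, huuinv, huuEu, huu0⟩ := exists_invariant_lift hX h hθ hθX hEu huinv hN
    (τ := -1) (Real.exp_pos _).le hr (fun x w hw => by
      rw [Real.exp_neg]
      exact poincareFlow_neg_le_of_expanding hX h huinv (Real.exp_pos _)
        (fun y v hv => by simpa using (hhyp 1 zero_le_one y).2 v hv) x hw)
  exact isAnosov_of_lifts hX hX0 h (fun x => (hcompl x).disjoint) hss huu hssinv huuinv hssEs huuEu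
    hss0 huu0 hN (half_pos hC) hhyp

end PAFlow
end

/-! ### Exterior derivatives and pullbacks of low regularity. -/

noncomputable section
namespace PAFlow
open Set Filter Metric Bundle

/-- The product of a differentiable function vanishing at a point with a continuous function is
differentiable there. -/
theorem hasFDerivAt_clm_comp_of_eq_zero {E F G H : Type*} [NormedAddCommGroup E] [NormedSpace ℝ E]
    [NormedAddCommGroup F] [NormedSpace ℝ F] [NormedAddCommGroup G] [NormedSpace ℝ G]
    [NormedAddCommGroup H] [NormedSpace ℝ H]
    {p : E → G →L[ℝ] H} {p' : E →L[ℝ] G →L[ℝ] H} {D : E → F →L[ℝ] G} {x : E}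
    (hp : HasFDerivAt p p' x) (hp0 : p x = 0) (hD : ContinuousAt D x) :
    HasFDerivAt (fun z => (p z).comp (D z))
      (((ContinuousLinearMap.compL ℝ F G H).flip (D x)).comp p') x := by
  rw [hasFDerivAt_iff_isLittleO, Asymptotics.isLittleO_iff]
  intro c hc
  obtain ⟨B, hB, hDB⟩ : ∃ B : ℝ, 0 < B ∧ ∀ᶠ z in 𝓝 x, ‖D z‖ < B :=
    ⟨‖D x‖ + 1, by positivity, hD.norm.eventually (gt_mem_nhds (lt_add_one _))⟩
  have hp1 := Asymptotics.isLittleO_iff.1 (hasFDerivAt_iff_isLittleO.1 hp)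
    (show 0 < c / (2 * B) by positivity)
  have hD1 : ∀ᶠ z in 𝓝 x, ‖D z - D x‖ < c / (2 * (‖p'‖ + 1)) := by
    have := (tendsto_iff_norm_sub_tendsto_zero.1 hD).eventually
      (gt_mem_nhds (show 0 < c / (2 * (‖p'‖ + 1)) by positivity))
    exact this
  filter_upwards [hDB, hp1, hD1] with z h1 h2 h3
  -- In the second term `p' (z - x)` is `O(‖z - x‖)` and `D z - D x` tends to 0, so continuity of
  -- `D` suffices where `p` vanishes.
  have he : (p z).comp (D z) - (p x).comp (D x) -
      (((ContinuousLinearMap.compL ℝ F G H).flip (D x)).comp p') (z - x) =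
      (p z - p x - p' (z - x)).comp (D z) + (p' (z - x)).comp (D z - D x) := by
    rw [hp0]
    ext w
    simp only [ContinuousLinearMap.comp_apply, ContinuousLinearMap.flip_apply,
      ContinuousLinearMap.compL_apply, sub_apply, add_apply, zero_apply, map_sub]
    abel
  rw [he]
  calc _ ≤ ‖p z - p x - p' (z - x)‖ * ‖D z‖ + ‖p' (z - x)‖ * ‖D z - D x‖ :=
        (norm_add_le _ _).trans (add_le_add (ContinuousLinearMap.opNorm_comp_le _ _)
          (ContinuousLinearMap.opNorm_comp_le _ _))
    _ ≤ (c / (2 * B) * ‖z - x‖) * B + ((‖p'‖ + 1) * ‖z - x‖) * (c / (2 * (‖p'‖ + 1))) := by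
        have h4 : ‖p' (z - x)‖ ≤ (‖p'‖ + 1) * ‖z - x‖ :=
          (p'.le_opNorm _).trans (by gcongr; linarith)
        gcongr
    _ = c * ‖z - x‖ := by
        field_simp
        ring

/-- The exterior derivative of a `1`-form commutes with the pullback by a `C^1` map, as soon as the
form and its pullback are differentiable. -/
theorem fderiv_sub_fderiv_of_pullback {E F : Type*} [NormedAddCommGroup E] [NormedSpace ℝ E]
    [NormedAddCommGroup F] [NormedSpace ℝ F] {a : F → F →L[ℝ] ℝ} {b : E → E →L[ℝ] ℝ} {ψ : E → F}
    {x : E} {a' : F →L[ℝ] F →L[ℝ] ℝ} {b' : E →L[ℝ] E →L[ℝ] ℝ} {D : E → E →L[ℝ] F}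
    (hψ : ∀ᶠ z in 𝓝 x, HasFDerivAt ψ (D z) z) (hD : ContinuousAt D x)
    (ha : HasFDerivAt a a' (ψ x)) (hb : HasFDerivAt b b' x)
    (hab : ∀ᶠ z in 𝓝 x, b z = (a (ψ z)).comp (D z)) (u v : E) :
    b' u v - b' v u = a' (D x u) (D x v) - a' (D x v) (D x u) := by
  -- Since `D` need not be differentiable, the covector is frozen at `a (ψ x)`. The remainder `(a (ψ
  -- z) - a (ψ x)) ∘ D z` is differentiable at `x` because its first factor vanishes there.
  -- Subtracting it from `b` makes `a (ψ x) ∘ D` differentiable at `x`; this is the derivative of a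
  -- scalar function, so second-derivative symmetry applies.
  have h1 : ∀ᶠ z in 𝓝 x, HasFDerivAt (fun z => a (ψ x) (ψ z)) ((a (ψ x)).comp (D z)) z :=
    hψ.mono fun z hz => (a (ψ x)).hasFDerivAt.comp z hz
  have h2 : HasFDerivAt (fun z => a (ψ z) - a (ψ x)) (a'.comp (D x)) x :=
    (ha.comp x hψ.self_of_nhds).sub_const _
  have h3 := hb.sub (hasFDerivAt_clm_comp_of_eq_zero h2 (sub_self _) hD)
  have h4 : HasFDerivAt (fun z => (a (ψ x)).comp (D z))
      (b' - ((ContinuousLinearMap.compL ℝ E F ℝ).flip (D x)).comp (a'.comp (D x))) x := by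
    refine h3.congr_of_eventuallyEq (hab.mono fun z hz => ?_)
    simp [hz]
  have h5 := second_derivative_symmetric_of_eventually h1 h4 u v
  simp only [sub_apply, ContinuousLinearMap.comp_apply,
    ContinuousLinearMap.flip_apply, ContinuousLinearMap.compL_apply] at h5
  linarith

theorem wedgeOneTwo_apply (a : E3 →L[ℝ] ℝ) (b : E3 [⋀^Fin 2]→L[ℝ] ℝ) (v : Fin 3 → E3) :
    wedgeOneTwo a b v = a (v 0) * b ![v 1, v 2] - a (v 1) * b ![v 0, v 2] +
      a (v 2) * b ![v 0, v 1] := by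
  have h0 : Fin.removeNth 0 v = ![v 1, v 2] := by
    funext i
    fin_cases i <;> rfl
  have h1 : Fin.removeNth 1 v = ![v 0, v 2] := by
    funext i
    fin_cases i <;> rfl
  have h2 : Fin.removeNth 2 v = ![v 0, v 1] := by
    funext i
    fin_cases i <;> rfl
  rw [wedgeOneTwo, ContinuousAlternatingMap.alternatizeUncurryFin_apply, Fin.sum_univ_three,
    h0, h1, h2]
  simp
  ring

/-- Covectors, as alternating forms of degree one. -/
def covectorToAlternating : (E3 →L[ℝ] ℝ) →L[ℝ] E3 [⋀^Fin 1]→L[ℝ] ℝ :=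
  ((ContinuousAlternatingMap.ofSubsingletonLIE (0 : Fin 1)).toContinuousLinearEquiv :
    (E3 →L[ℝ] ℝ) ≃L[ℝ] E3 [⋀^Fin 1]→L[ℝ] ℝ).toContinuousLinearMap

theorem covectorToAlternating_apply (a : E3 →L[ℝ] ℝ) (v : Fin 1 → E3) :
    covectorToAlternating a v = a (v 0) := rfl

theorem extDerivOne_eq {a : E3 → E3 →L[ℝ] ℝ} {y : E3} (ha : DifferentiableAt ℝ a y) :
    extDerivOne a y = ContinuousAlternatingMap.alternatizeUncurryFinCLM ℝ E3 ℝ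
      (covectorToAlternating.comp (fderiv ℝ a y)) :=
  congrArg (ContinuousAlternatingMap.alternatizeUncurryFin)
    (covectorToAlternating.hasFDerivAt.comp y ha.hasFDerivAt).fderiv

theorem extDerivOne_apply {a : E3 → E3 →L[ℝ] ℝ} {y : E3} (ha : DifferentiableAt ℝ a y) (u v : E3) :
    extDerivOne a y ![u, v] = fderiv ℝ a y u v - fderiv ℝ a y v u := by
  have h : extDerivOne a y ![u, v] = ∑ i : Fin 2, (-1) ^ (i : ℕ) •
      covectorToAlternating (fderiv ℝ a y (![u, v] i)) (Fin.removeNth i ![u, v]) := by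
    rw [extDerivOne_eq ha]
    exact ContinuousAlternatingMap.alternatizeUncurryFin_apply _ _
  rw [h, Fin.sum_univ_two, covectorToAlternating_apply, covectorToAlternating_apply]
  change (-1) ^ 0 • fderiv ℝ a y u v + (-1) ^ 1 • fderiv ℝ a y v u = _
  simp
  ring

theorem continuousOn_wedgeOneTwo_extDerivOne {a : E3 → E3 →L[ℝ] ℝ} {U : Set E3} (hU : IsOpen U)
    (ha : ContDiffOn ℝ 1 a U) : ContinuousOn (fun y => wedgeOneTwo (a y) (extDerivOne a y)) U := by
  have h1 : ContinuousOn (extDerivOne a) U := by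
    refine ContinuousOn.congr (f := fun y => ContinuousAlternatingMap.alternatizeUncurryFinCLM ℝ E3 ℝ
      (covectorToAlternating.comp (fderiv ℝ a y))) ?_ fun y hy =>
        extDerivOne_eq ((ha.differentiableOn one_ne_zero).differentiableAt (hU.mem_nhds hy))
    have h2 := ha.continuousOn_fderiv_of_isOpen hU le_rfl
    fun_prop
  have h2 : ContinuousOn (fun y => ContinuousLinearMap.smulRightL ℝ E3 (E3 [⋀^Fin 2]→L[ℝ] ℝ)
      (a y) (extDerivOne a y)) U := by
    have := ha.continuousOn
    fun_prop
  exact (ContinuousAlternatingMap.alternatizeUncurryFinCLM ℝ E3 ℝ).continuous.comp_continuousOn h2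

/-- The value of `a ∧ da` on three vectors. -/
theorem wedgeOneTwo_extDerivOne_apply {a : E3 → E3 →L[ℝ] ℝ} {y : E3}
    (ha : DifferentiableAt ℝ a y) (v : Fin 3 → E3) :
    wedgeOneTwo (a y) (extDerivOne a y) v =
      a y (v 0) * (fderiv ℝ a y (v 1) (v 2) - fderiv ℝ a y (v 2) (v 1)) -
      a y (v 1) * (fderiv ℝ a y (v 0) (v 2) - fderiv ℝ a y (v 2) (v 0)) +
      a y (v 2) * (fderiv ℝ a y (v 0) (v 1) - fderiv ℝ a y (v 1) (v 0)) := by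
  rw [wedgeOneTwo_apply, extDerivOne_apply ha, extDerivOne_apply ha, extDerivOne_apply ha]

/-- Multiplying `a` by a function multiplies `a ∧ da` by its square. -/
theorem wedgeOneTwo_extDerivOne_smul {a : E3 → E3 →L[ℝ] ℝ} {F : E3 → ℝ} {y : E3}
    (ha : DifferentiableAt ℝ a y) (hF : DifferentiableAt ℝ F y) :
    wedgeOneTwo (F y • a y) (extDerivOne (fun z => F z • a z) y) =
      F y ^ 2 • wedgeOneTwo (a y) (extDerivOne a y) := by
  ext v
  have h1 : ∀ u w, fderiv ℝ (fun z => F z • a z) y u w =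
      F y * fderiv ℝ a y u w + fderiv ℝ F y u * a y w := fun u w => by
    rw [fderiv_fun_smul hF ha]
    simp
  have h2 := wedgeOneTwo_extDerivOne_apply (a := fun z => F z • a z) (hF.smul ha) v
  rw [h2]
  simp only [h1, ContinuousAlternatingMap.smul_apply, wedgeOneTwo_extDerivOne_apply ha, smul_apply,
    smul_eq_mul]
  -- The terms containing `dF` cancel, since `a ∧ dF ∧ a = 0`.
  ring

/-- The form `a ∧ da` is natural under pullbacks by `C^1` maps. -/
theorem wedgeOneTwo_extDerivOne_of_pullback {a b : E3 → E3 →L[ℝ] ℝ} {ψ : E3 → E3}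
    {x : E3} {D : E3 → E3 →L[ℝ] E3}
    (hψ : ∀ᶠ z in 𝓝 x, HasFDerivAt ψ (D z) z) (hD : ContinuousAt D x)
    (ha : DifferentiableAt ℝ a (ψ x)) (hb : DifferentiableAt ℝ b x)
    (hab : ∀ᶠ z in 𝓝 x, b z = (a (ψ z)).comp (D z)) :
    (wedgeOneTwo (a (ψ x)) (extDerivOne a (ψ x))).compContinuousLinearMap (D x) =
      wedgeOneTwo (b x) (extDerivOne b x) := by
  ext v
  have h := fderiv_sub_fderiv_of_pullback hψ hD ha.hasFDerivAt hb.hasFDerivAt hab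
  rw [wedgeOneTwo_extDerivOne_apply hb, h, h, h, hab.self_of_nhds]
  exact wedgeOneTwo_extDerivOne_apply ha _

end PAFlow
end

/-! ### The invariant volume form of a contact flow. -/

noncomputable section
namespace PAFlow
open Set Filter Metric Bundle

universe u
variable {M : Type u} [TopologicalSpace M] [ChartedSpace E3 M]

/-- The coordinate expression of `α ∧ dα` in the chart at `x₀`. -/
def contactFormInChart (α : OneForm M) (x₀ : M) (y : E3) : E3 [⋀^Fin 3]→L[ℝ] ℝ :=
  wedgeOneTwo (oneFormInChart α x₀ y) (extDerivOne (oneFormInChart α x₀) y)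

/-- The `3`-form `α ∧ dα`. -/
def contactVolume (α : OneForm M) : ThreeForm M := fun x =>
  (contactFormInChart α x (extChartAt (𝓡 3) x x)).compContinuousLinearMap (chartDeriv x x)

theorem oneFormInChart_apply (α : OneForm M) (x₀ : M) (y v : E3) :
    oneFormInChart α x₀ y v =
      α ((extChartAt (𝓡 3) x₀).symm y) (chartSymmDeriv x₀ y v) := rfl

variable [IsManifold (𝓡 3) ∞ M]

theorem oneFormInChart_chartDeriv (α : OneForm M) {x₀ x : M}
    (hx : x ∈ (extChartAt (𝓡 3) x₀).source) (v : E3) :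
    oneFormInChart α x₀ (extChartAt (𝓡 3) x₀ x) (chartDeriv x₀ x v) = α x v := by
  have h1 : ∀ z : M, z = x → (α z : E3 →L[ℝ] ℝ) v = (α x : E3 →L[ℝ] ℝ) v := by
    rintro z rfl; rfl
  rw [oneFormInChart_apply, chartSymmDeriv_chartDeriv hx]
  exact h1 _ ((extChartAt (𝓡 3) x₀).left_inv hx)

/-- The derivative of a map of manifolds read in charts. -/
theorem hasFDerivAt_extChartAt_comp {f : M → M} {x₀ x₁ : M} {y : E3}
    (hy : y ∈ (extChartAt (𝓡 3) x₀).target)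
    (hf : MDifferentiableAt (𝓡 3) (𝓡 3) f ((extChartAt (𝓡 3) x₀).symm y))
    (hfy : f ((extChartAt (𝓡 3) x₀).symm y) ∈ (extChartAt (𝓡 3) x₁).source) :
    HasFDerivAt (fun z => extChartAt (𝓡 3) x₁ (f ((extChartAt (𝓡 3) x₀).symm z)))
      ((chartDeriv x₁ (f ((extChartAt (𝓡 3) x₀).symm y))).comp
        ((mfderiv (𝓡 3) (𝓡 3) f ((extChartAt (𝓡 3) x₀).symm y) : E3 →L[ℝ] E3).comp
          (chartSymmDeriv x₀ y))) y := by
  have : IsManifold (𝓡 3) 1 M := inferInstance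
  have h1 : MDifferentiableAt 𝓘(ℝ, E3) (𝓡 3) (extChartAt (𝓡 3) x₀).symm y :=
    ((contMDiffOn_extChartAt_symm (n := 1) x₀).contMDiffAt
      ((isOpen_extChartAt_target x₀).mem_nhds hy)).mdifferentiableAt one_ne_zero
  have h2 := (mdifferentiableAt_extChartAt (I := 𝓡 3) (x := x₁)
    (by rwa [extChartAt_source] at hfy)).hasMFDerivAt
  exact (HasMFDerivAt.comp y h2 (HasMFDerivAt.comp y hf.hasMFDerivAt h1.hasMFDerivAt)).hasFDerivAt

/-- The form `α ∧ dα` is natural under `C^1` maps preserving `α`. -/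
theorem contactFormInChart_map {α : OneForm M}
    (hα : ∀ x₀, ContDiffOn ℝ 1 (oneFormInChart α x₀) (extChartAt (𝓡 3) x₀).target)
    {f : M → M} (hf : ContMDiff (𝓡 3) (𝓡 3) 1 f)
    (hfα : ∀ z (v : TangentSpace (𝓡 3) z), α (f z) (mfderiv (𝓡 3) (𝓡 3) f z v) = α z v)
    {x₀ x₁ x : M} (hx : x ∈ (extChartAt (𝓡 3) x₀).source)
    (hfx : f x ∈ (extChartAt (𝓡 3) x₁).source) (v : Fin 3 → E3) :
    contactFormInChart α x₁ (extChartAt (𝓡 3) x₁ (f x))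
        (fun i => chartDeriv x₁ (f x) (mfderiv (𝓡 3) (𝓡 3) f x (v i))) =
      contactFormInChart α x₀ (extChartAt (𝓡 3) x₀ x) (fun i => chartDeriv x₀ x (v i)) := by
  have : IsManifold (𝓡 3) 1 M := inferInstance
  set c := extChartAt (𝓡 3) x₀ with hc
  set ψ : E3 → E3 := fun z => extChartAt (𝓡 3) x₁ (f (c.symm z)) with hψdef
  have hcx : c x ∈ c.target := c.map_source hx
  have hψ : ContDiffAt ℝ 1 ψ (c x) := by
    have hxs := hx
    rw [hc, extChartAt_source] at hxs
    have hfs := hfx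
    rw [extChartAt_source] at hfs
    have h1 := ((contMDiffAt_iff_of_mem_source hxs hfs).1 hf.contMDiffAt).2
    rwa [ModelWithCorners.range_eq_univ, contDiffWithinAt_univ] at h1
  have hψx : ψ (c x) = extChartAt (𝓡 3) x₁ (f x) := by
    rw [hψdef]
    simp only [c.left_inv hx]
  have hnear : ∀ᶠ z in 𝓝 (c x), z ∈ c.target ∧ f (c.symm z) ∈ (extChartAt (𝓡 3) x₁).source := by
    refine Filter.Eventually.and ((isOpen_extChartAt_target x₀).eventually_mem hcx) ?_
    have h1 : ContinuousAt (fun z => f (c.symm z)) (c x) :=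
      hf.continuous.continuousAt.comp (continuousAt_extChartAt_symm' hx)
    refine h1.eventually ((isOpen_extChartAt_source x₁).mem_nhds ?_)
    change f (c.symm (c x)) ∈ _
    rwa [c.left_inv hx]
  have hdiff : ∀ z, MDifferentiableAt (𝓡 3) (𝓡 3) f z := fun z =>
    hf.contMDiffAt.mdifferentiableAt one_ne_zero
  have hder : ∀ z ∈ c.target, f (c.symm z) ∈ (extChartAt (𝓡 3) x₁).source → ∀ w : E3,
      fderiv ℝ ψ z w = chartDeriv x₁ (f (c.symm z))
        (mfderiv (𝓡 3) (𝓡 3) f (c.symm z) (chartSymmDeriv x₀ z w)) := fun z hz hfz w =>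
    congrArg (fun A : E3 →L[ℝ] E3 => A w) (hasFDerivAt_extChartAt_comp hz (hdiff _) hfz).fderiv
  have h := wedgeOneTwo_extDerivOne_of_pullback (a := oneFormInChart α x₁)
    (b := oneFormInChart α x₀) (ψ := ψ) (D := fderiv ℝ ψ) (x := c x)
    (hnear.mono fun z hz =>
      (hasFDerivAt_extChartAt_comp hz.1 (hdiff _) hz.2).differentiableAt.hasFDerivAt)
    (hψ.continuousAt_fderiv one_ne_zero)
    (((hα x₁).differentiableOn one_ne_zero).differentiableAt
      ((isOpen_extChartAt_target x₁).mem_nhds (by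
        rw [hψx]
        exact (extChartAt (𝓡 3) x₁).map_source hfx)))
    (((hα x₀).differentiableOn one_ne_zero).differentiableAt
      ((isOpen_extChartAt_target x₀).mem_nhds hcx))
    (hnear.mono fun z hz => by
      ext w
      rw [ContinuousLinearMap.comp_apply, hder z hz.1 hz.2 w]
      exact (hfα _ _).symm.trans (oneFormInChart_chartDeriv α hz.2 _).symm)
  have h1 : ∀ i, fderiv ℝ ψ (c x) (chartDeriv x₀ x (v i)) =
      chartDeriv x₁ (f x) (mfderiv (𝓡 3) (𝓡 3) f x (v i)) := fun i => by
    have h2 : ∀ z : M, z = x → ∀ w : E3, chartDeriv x₁ (f z) (mfderiv (𝓡 3) (𝓡 3) f z w) =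
        chartDeriv x₁ (f x) (mfderiv (𝓡 3) (𝓡 3) f x w) := by
      rintro z rfl w; rfl
    rw [hder _ hcx (by rwa [c.left_inv hx]), chartSymmDeriv_chartDeriv hx]
    exact h2 _ (c.left_inv hx) _
  have h3 := congrArg (fun A : E3 [⋀^Fin 3]→L[ℝ] ℝ => A fun i => chartDeriv x₀ x (v i)) h
  rw [← hψx]
  simp only [← h1]
  exact h3

/-- This is independence of the chart, obtained from naturality for the identity map read in two
charts. It is needed because `contactVolume` uses at each point the preferred chart there. -/
theorem contactFormInChart_chartDeriv {α : OneForm M}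
    (hα : ∀ x₀, ContDiffOn ℝ 1 (oneFormInChart α x₀) (extChartAt (𝓡 3) x₀).target)
    {x₀ x : M} (hx : x ∈ (extChartAt (𝓡 3) x₀).source) (v : Fin 3 → E3) :
    contactFormInChart α x₀ (extChartAt (𝓡 3) x₀ x) (fun i => chartDeriv x₀ x (v i)) =
      contactVolume α x v := by
  have h : ∀ z (v : TangentSpace (𝓡 3) z), mfderiv (𝓡 3) (𝓡 3) (id : M → M) z v = v := fun z v => by
    rw [mfderiv_id]
    rfl
  have h1 := contactFormInChart_map hα (f := id) contMDiff_id (fun z v => congrArg _ (h z v))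
    (x₁ := x) hx (mem_extChartAt_source x) v
  refine h1.symm.trans ?_
  change contactFormInChart α x (extChartAt (𝓡 3) x x) (fun i => chartDeriv x x _) =
    contactFormInChart α x (extChartAt (𝓡 3) x x) (fun i => chartDeriv x x (v i))
  refine congrArg _ (funext fun i => congrArg (chartDeriv x x) (h x (v i)))

theorem threeFormInChart_contactVolume {α : OneForm M}
    (hα : ∀ x₀, ContDiffOn ℝ 1 (oneFormInChart α x₀) (extChartAt (𝓡 3) x₀).target)
    {x₀ : M} {y : E3} (hy : y ∈ (extChartAt (𝓡 3) x₀).target) :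
    threeFormInChart (contactVolume α) x₀ y = contactFormInChart α x₀ y := by
  ext v
  have h := contactFormInChart_chartDeriv hα ((extChartAt (𝓡 3) x₀).map_target hy)
    (fun i => chartSymmDeriv x₀ y (v i))
  simp only [chartDeriv_chartSymmDeriv hy] at h
  rw [(extChartAt (𝓡 3) x₀).right_inv hy] at h
  exact h.symm

theorem isC0VolumeForm_contactVolume {α : OneForm M} (hα : IsContactForm α) :
    IsC0VolumeForm (contactVolume α) := by
  have h1 := fun x₀ => (hα x₀).1
  refine ⟨fun x₀ => ?_, fun x hx => ?_⟩
  · exact (continuousOn_wedgeOneTwo_extDerivOne (isOpen_extChartAt_target x₀) (h1 x₀)).congr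
      fun y hy => threeFormInChart_contactVolume h1 hy
  · refine (hα x).2 (extChartAt (𝓡 3) x x) (mem_extChartAt_target x) ?_
    refine (threeFormInChart_contactVolume h1 (mem_extChartAt_target x)).symm.trans ?_
    have h2 : ∀ z, z = x → contactVolume α z = 0 := by
      rintro z rfl
      exact hx
    rw [threeFormInChart, h2 _ (extChartAt_to_inv x)]
    rfl

/-- A `C^1` map preserving `α` preserves `α ∧ dα`. -/
theorem contactVolume_map {α : OneForm M}
    (hα : ∀ x₀, ContDiffOn ℝ 1 (oneFormInChart α x₀) (extChartAt (𝓡 3) x₀).target)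
    {f : M → M} (hf : ContMDiff (𝓡 3) (𝓡 3) 1 f)
    (hfα : ∀ z (v : TangentSpace (𝓡 3) z), α (f z) (mfderiv (𝓡 3) (𝓡 3) f z v) = α z v) (x : M) :
    (contactVolume α (f x)).compContinuousLinearMap (mfderiv (𝓡 3) (𝓡 3) f x) =
      contactVolume α x := by
  ext v
  exact contactFormInChart_map hα hf hfα (mem_extChartAt_source x) (mem_extChartAt_source (f x)) v

omit [IsManifold (𝓡 3) ∞ M] in
/-- Multiplying a contact form by a nowhere-vanishing function which is `C^1` in charts yields a
contact form. -/
theorem IsContactForm.smul {α : OneForm M} (hα : IsContactForm α) {F : M → ℝ} (hF0 : ∀ x, F x ≠ 0)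
    (hF : ∀ x₀, ContDiffOn ℝ 1 (fun y => F ((extChartAt (𝓡 3) x₀).symm y))
      (extChartAt (𝓡 3) x₀).target) : IsContactForm (fun x => F x • α x) := by
  intro x₀
  have h1 : oneFormInChart (fun x => F x • α x) x₀ =
      fun y => F ((extChartAt (𝓡 3) x₀).symm y) • oneFormInChart α x₀ y := rfl
  rw [h1]
  refine ⟨(hF x₀).smul (hα x₀).1, fun y hy => ?_⟩
  have hn := (isOpen_extChartAt_target (I := 𝓡 3) x₀).mem_nhds hy
  have h2 := wedgeOneTwo_extDerivOne_smul
    (((hα x₀).1.differentiableOn one_ne_zero).differentiableAt hn)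
    (((hF x₀).differentiableOn one_ne_zero).differentiableAt hn)
  rw [h2]
  exact smul_ne_zero (pow_ne_zero _ (hF0 _)) ((hα x₀).2 y hy)

variable [CompactSpace M] {X : VField M} {φ : Flow ℝ M}

/-- A contact flow preserves a contact form. -/
theorem exists_invariant_contactForm (hX : IsC1Field X) (h : Generates X φ)
    (hc : IsContactFlow X φ) :
    ∃ α : OneForm M, IsContactForm α ∧
      ∀ t x (v : TangentSpace (𝓡 3) x), α (φ t x) (dflow φ t x v) = α x v := by
  obtain ⟨ξ, ⟨α, hα, hξ⟩, hXξ, hinv⟩ := hc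
  have h0 : ∀ x, α x (X x) ≠ 0 := fun x hx => hXξ x (by
    rw [hξ x]
    exact hx)
  -- Normalised to be 1 on `X`, a form with kernel `ξ` is determined by `X` and `ξ`. Both are
  -- preserved by the flow, hence so is the form.
  refine ⟨fun x => (α x (X x))⁻¹ • α x, hα.smul (fun x => inv_ne_zero (h0 x)) fun x₀ => ?_, ?_⟩
  · have h1 : ∀ y ∈ (extChartAt (𝓡 3) x₀).target,
        oneFormInChart α x₀ y (chartField X x₀ y) =
          α ((extChartAt (𝓡 3) x₀).symm y) (X ((extChartAt (𝓡 3) x₀).symm y)) := fun y hy => by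
      have h2 := oneFormInChart_chartDeriv α ((extChartAt (𝓡 3) x₀).map_target hy)
        (X ((extChartAt (𝓡 3) x₀).symm y))
      rw [(extChartAt (𝓡 3) x₀).right_inv hy] at h2
      exact h2
    refine (((hα x₀).1.clm_apply (contDiffOn_chartField hX x₀)).inv fun y hy => ?_).congr
      fun y hy => ?_
    · rw [h1 y hy]
      exact h0 _
    · exact congrArg (·⁻¹) (h1 y hy).symm
  · intro t x v
    change (α (φ t x) (X (φ t x)))⁻¹ * α (φ t x) (dflow φ t x v) = (α x (X x))⁻¹ * α x v
    obtain ⟨c, hc⟩ : ∃ c, c = (α x (X x))⁻¹ * α x v := ⟨_, rfl⟩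
    -- This splits `v` into its component along `X` and a vector of the contact plane.
    have hker : v - c • X x ∈ ξ x := by
      rw [hξ x]
      change α x (v - c • X x) = 0
      rw [map_sub, map_smul, hc, smul_eq_mul]
      field_simp [h0 x]
      ring
    have h2 : dflow φ t x (v - c • X x) ∈ ξ (φ t x) := by
      rw [← hinv t x]
      exact ⟨_, hker, rfl⟩
    rw [hξ] at h2
    have h3 : α (φ t x) (dflow φ t x (v - c • X x)) = 0 := h2
    rw [map_sub, map_smul, dflow_generator hX h, map_sub, map_smul, sub_eq_zero, smul_eq_mul] at h3
    rw [h3, ← hc]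
    field_simp [h0 (φ t x)]

/-- A contact flow preserves a continuous volume form. -/
theorem exists_preservesForm_of_isContactFlow (hX : IsC1Field X) (h : Generates X φ)
    (hc : IsContactFlow X φ) : ∃ Ω : ThreeForm M, IsC0VolumeForm Ω ∧ PreservesForm φ Ω := by
  obtain ⟨α, hα, hαφ⟩ := exists_invariant_contactForm hX h hc
  exact ⟨contactVolume α, isC0VolumeForm_contactVolume hα, fun t x =>
    contactVolume_map (fun x₀ => (hα x₀).1) (contMDiff_flow hX h t) (hαφ t) x⟩

end PAFlow
end

theorem mainTheorem3 {M : Type*} [TopologicalSpace M] [ChartedSpace PAFlow.E3 M]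
    [IsManifold (𝓡 3) ∞ M] [T2Space M] [CompactSpace M] [ConnectedSpace M]
    (X : PAFlow.VField M) (hX : PAFlow.IsC1Field X) (hX0 : ∀ x, X x ≠ 0)
    (φ : Flow ℝ M) (hφ : PAFlow.Generates X φ)
    (hPA : PAFlow.IsProjectivelyAnosov hφ) :
    ((∃ Ω : PAFlow.ThreeForm M, PAFlow.IsC0VolumeForm Ω ∧ PAFlow.PreservesForm φ Ω) →
      PAFlow.IsAnosov X φ) ∧
    (PAFlow.IsContactFlow X φ → PAFlow.IsAnosov X φ) := by
  have h1 : ∀ Ω : PAFlow.ThreeForm M, PAFlow.IsC0VolumeForm Ω → PAFlow.PreservesForm φ Ω →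
      PAFlow.IsAnosov X φ := fun Ω hΩ hΩφ =>
    PAFlow.isAnosov_of_preservesForm hX hX0 hφ hPA hΩ hΩφ
  refine ⟨fun ⟨Ω, hΩ, hΩφ⟩ => h1 Ω hΩ hΩφ, fun hc => ?_⟩
  obtain ⟨Ω, hΩ, hΩφ⟩ := PAFlow.exists_preservesForm_of_isContactFlow hX hφ hc
  exact h1 Ω hΩ hΩφ
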